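/- For integers $n\ge 0$, $p\ge 1$ and a root of unity $y\in\mathbb C$ put $\zeta_n(p;y)=\sum_{k=1}^n \frac{y^k}{k^p}$ and $t_n(p;y)=\sum_{k=1}^n \frac{y^k}{(k-1/2)^p}$. For $k\ge 0$, integers $p_1,\dots,p_k,q\ge 1$ and roots of unity $x_1,\dots,x_k,x$ with $(q,x)\ne(1,1)$, the cyclotomic Euler $\tilde S$-sum and $R$-sum of order $k$ are the (possibly only conditionally) convergent series $$\tilde S_{p_1,\dots,p_k;q}(x_1,\dots,x_k;x)=\sum_{n=1}^\infty \frac{t_n(p_1;x_1)\cdots t_n(p_k;x_k)}{n^q}\,x^n,\qquad R_{p_1,\dots,p_k;q}(x_1,\dots,x_k;x)=\sum_{n=0}^\infty \frac{\zeta_n(p_1;x_1)\cdots \zeta_n(p_k;x_k)}{(n+1/2)^q}\,x^n ,$$ where empty products are $1$. Theorem 1.2. Let $r\ge 1$, let $x,x_1,\dots,x_r$ be roots of unity, and let $p_1,\dots,p_r,q\ge 1$ be integers with $(p_j,x_j)\neq(1,1)$ for $j=1,\dots,r$ and $(q,x)\ne(1,1)$. Then the series below converge, and $$(x_1\cdots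 x_r)^{-1}\,\tilde S_{p_1,\dots,p_r;q}(x_1,\dots,x_r;x)+(-1)^{p_1+\cdots+p_r+q+r}\,\tilde S_{p_1,\dots,p_r;q}(x_1^{-1},\dots,x_r^{-1};x^{-1})$$ is a linear combination, with coefficients in the field $\mathbb Q(x,x_1,\dots,x_r)$, of products of cyclotomic Euler $\tilde S$-sums and $R$-sums of orders $<r$ (the empty product $1$ being allowed). -/

import Mathlib

open Filter Topology

/-- The cyclotomic harmonic number `ζ_n(p; x) = ∑_{k=1}^n x^k / k^p`. -/
noncomputable def cycHarmonic (p : ℕ) (x : ℂ) (n : ℕ) : ℂ :=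
  ∑ k ∈ Finset.Icc 1 n, x ^ k / (k : ℂ) ^ p

/-- The cyclotomic odd harmonic number `t_n(p; x) = ∑_{k=1}^n x^k / (k - 1/2)^p`. -/
noncomputable def cycOddHarmonic (p : ℕ) (x : ℂ) (n : ℕ) : ℂ :=
  ∑ k ∈ Finset.Icc 1 n, x ^ k / ((k : ℂ) - 1 / 2) ^ p

/-- `z` is the value of the cyclotomic Euler `S̃`-sum
`S̃_{p_1,…,p_k;q}(y_1,…,y_k;x) = ∑_{n ≥ 1} t_n(p_1;y_1) ⋯ t_n(p_k;y_k) x^n / n^q`,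
the series being the limit of its partial sums (for `q = 1` it need not converge absolutely).
For `k = 0` this is the polylogarithm `Li_q(x)`. -/
def IsTildeSSum {k : ℕ} (p : Fin k → ℕ) (q : ℕ) (y : Fin k → ℂ) (x z : ℂ) : Prop :=
  Tendsto (fun N : ℕ => ∑ n ∈ Finset.Icc 1 N,
      (∏ j, cycOddHarmonic (p j) (y j) n) / (n : ℂ) ^ q * x ^ n) atTop (𝓝 z)

/-- `z` is the value of the cyclotomic Euler `R`-sum
`R_{p_1,…,p_k;q}(y_1,…,y_k;x) = ∑_{n ≥ 0} ζ_n(p_1;y_1) ⋯ ζ_n(p_k;y_k) x^n / (n + 1/2)^q`,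
the series being the limit of its partial sums. For `k = 0` this is
`x⁻¹ ∑_{n ≥ 1} x^n / (n - 1/2)^q`. -/
def IsRSum {k : ℕ} (p : Fin k → ℕ) (q : ℕ) (y : Fin k → ℂ) (x z : ℂ) : Prop :=
  Tendsto (fun N : ℕ => ∑ n ∈ Finset.range N,
      (∏ j, cycHarmonic (p j) (y j) n) / ((n : ℂ) + 1 / 2) ^ q * x ^ n) atTop (𝓝 z)

/-- The set of values of all cyclotomic Euler `S̃`-sums and `R`-sums of order `k < r`
(arbitrary positive exponents, arguments arbitrary roots of unity, `(q, x) ≠ (1, 1)`). -/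
def lowerOrderSums (r : ℕ) : Set ℂ :=
  {z | ∃ k < r, ∃ (p : Fin k → ℕ) (q : ℕ) (y : Fin k → ℂ) (x : ℂ),
    (∀ j, 1 ≤ p j) ∧ 1 ≤ q ∧ (∀ j, IsOfFinOrder (y j)) ∧ IsOfFinOrder x ∧
    (q, x) ≠ (1, 1) ∧ (IsTildeSSum p q y x z ∨ IsRSum p q y x z)}

/-! The proof is a residue argument carried out by hand on rational functions. Put Y = ∏ y_j, X =
xY, and F_M(s) = s^(-q) ∏_j ∑_{k ≤ M} y_j^k / (s + k + 1/2)^(p_j). The symmetric sum of X^m F_M(m)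
over nonzero integers m is computed in two ways, and then M tends to infinity.

Direct evaluation: extend t_n(p; y) to all integers n by its recurrence. Each inner sum is then a
difference of two values of t, so X^m F_M(m) equals Y⁻¹ x^m m^(-q) ∏_j (t_{m+M+1} - t_m). As M
grows, t_{m+M+1} tends to a constant T_j. Expanding ∏_j (T_j - t_m) leaves one product of r factors
t_m, and everything else has lower order. Positive m give the S̃-sum; negative m give the one with
inverted arguments, because t_{-n}(p; y) = (-1)^(p+1) y t_n(p; y⁻¹). These two top terms form the
left side of the parity formula up to the sign (-1)^r (`tildeSSum_parity`).

Partial fractions: F_M is the sum of its principal parts at 0 and at the points -(n + 1/2)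
(`partial_fraction_expansion`). The symmetric sum of X^m / (m + n + 1/2)^i is X^(-n) D_i minus its
term at m = 0, with D_i independent of n, so only the coefficients need attention. At 0 they tend to
polynomials in limits of the t_n. At -(n + 1/2) the product of the r factors is s^(-∑ p_j) ∏_j (1 +
s^(p_j) G_j) up to a constant, and the term with all the G_j is holomorphic, so no principal part
sees it. Hence at most r - 1 factors ζ_n occur, and summing over n gives R-sums of order less than r
(`hasWeightedLimits_coeff_at_pole`).

The analytic difficulty is the limit M → ∞ under series that converge only conditionally. The notion
`IsTame` and the lemma `IsTame.tendsto_sum` handle every such interchange. -/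

/-! ### Convergence of harmonic numbers at rate O(1/n). -/

lemma exists_tail_bound {h v e : ℕ → ℂ} {K : ℝ}
    (hrec : ∀ n, h (n + 1) - h n = v (n + 1) - v n + e n)
    (hv : ∀ n, ‖v n‖ ≤ K / (n + 1)) (he : ∀ n : ℕ, ‖e n‖ ≤ K / ((n + 1) * (n + 2))) :
    ∃ (T : ℂ) (K' : ℝ), ∀ n : ℕ, ‖h n - T‖ ≤ K' / (n + 1) := by
  -- The error K / ((n + 1)(n + 2)) telescopes as K/(n + 1) - K/(n + 2), so h - v is Cauchy with an
  -- explicit rate.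
  have key : ∀ n d : ℕ, ‖(h (n + d) - v (n + d)) - (h n - v n)‖
      ≤ K / (n + 1) - K / ((n + d : ℕ) + 1) := by
    intro n d
    induction d with
    | zero => simp
    | succ d ih =>
      have h1 : (h (n + (d + 1)) - v (n + (d + 1))) - (h n - v n)
          = ((h (n + d) - v (n + d)) - (h n - v n)) + e (n + d) := by
        have := hrec (n + d)
        rw [← add_assoc]
        linear_combination this
      rw [h1]
      refine (norm_add_le _ _).trans ((add_le_add ih (he _)).trans (le_of_eq ?_))
      push_cast
      have h2 : ((n : ℝ) + d + 1) ≠ 0 := by positivity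
      have h3 : ((n : ℝ) + d + 2) ≠ 0 := by positivity
      have h4 : ((n : ℝ) + (d + 1) + 1) ≠ 0 := by positivity
      field_simp
      ring
  have hK : 0 ≤ K := by
    have := (norm_nonneg _).trans (hv 0)
    simpa using this
  have key2 : ∀ n m : ℕ, n ≤ m → dist (h n - v n) (h m - v m) ≤ K / (n + 1) := by
    intro n m hnm
    obtain ⟨d, rfl⟩ := Nat.exists_eq_add_of_le hnm
    rw [dist_comm, dist_eq_norm]
    refine (key n d).trans ?_
    have : 0 ≤ K / (((n + d : ℕ) : ℝ) + 1) := by positivity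
    linarith
  have hlim : Tendsto (fun n : ℕ => K / ((n : ℝ) + 1)) atTop (𝓝 0) := by
    have := (tendsto_one_div_add_atTop_nhds_zero_nat (𝕜 := ℝ)).const_mul K
    simpa [div_eq_mul_inv] using this
  obtain ⟨T, hT⟩ := cauchySeq_tendsto_of_complete (cauchySeq_of_le_tendsto_0' _ key2 hlim)
  refine ⟨T, 2 * K, fun n => ?_⟩
  have h1 : dist (h n - v n) T ≤ K / (n + 1) :=
    le_of_tendsto (tendsto_const_nhds.dist hT) (eventually_atTop.2 ⟨n, key2 n⟩)
  rw [dist_eq_norm] at h1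
  have h2 : h n - T = (h n - v n - T) + v n := by ring
  rw [h2]
  refine (norm_add_le _ _).trans ((add_le_add h1 (hv n)).trans (le_of_eq ?_))
  ring

/-- Shifted cyclotomic harmonic numbers converge at rate `O(1/n)`. -/
lemma exists_tail_bound_shift {b : ℕ} {y : ℂ} {δ : ℝ} (hδ : δ ≤ 1 / 2)
    (hb : 1 ≤ b) (hy : ‖y‖ = 1) (hby : (b, y) ≠ (1, 1)) :
    ∃ (T : ℂ) (K : ℝ), ∀ n : ℕ,
      ‖∑ k ∈ Finset.Icc 1 n, y ^ k / ((k : ℂ) - δ) ^ b - T‖ ≤ K / (n + 1) := by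
  have hnorm : ∀ k : ℕ, ‖((k + 1 : ℕ) : ℂ) - δ‖ = (k : ℝ) + 1 - δ := by
    intro k
    have : ((k + 1 : ℕ) : ℂ) - δ = (((k : ℝ) + 1 - δ : ℝ) : ℂ) := by push_cast; ring
    rw [this, Complex.norm_real, Real.norm_of_nonneg]
    have : (0 : ℝ) ≤ k := by positivity
    linarith
  have hpos : ∀ k : ℕ, ((k : ℝ) + 1) / 2 ≤ (k : ℝ) + 1 - δ := by
    intro k
    have : (0 : ℝ) ≤ k := by positivity
    linarith
  have hne : ∀ k : ℕ, ((k + 1 : ℕ) : ℂ) - δ ≠ 0 := by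
    intro k
    rw [← norm_ne_zero_iff, hnorm]
    have := hpos k
    have : (0 : ℝ) ≤ k := by positivity
    linarith
  by_cases hb1 : b = 1
  · subst hb1
    have hy1 : y - 1 ≠ 0 := by
      intro h
      exact hby (by rw [sub_eq_zero.1 h])
    have hy1' : 0 < ‖y - 1‖ := norm_pos_iff.2 hy1
    -- Abel summation: y^(n+1) = (y^(n+2) - y^(n+1)) / (y - 1), so the increment is a boundary
    -- difference plus a term of size O(1/n²). The 4 in `K` comes from bounding n + 1 - δ below by
    -- (n + 1)/2 twice.
    refine exists_tail_bound (v := fun n => y ^ (n + 1) / (((n + 1 : ℕ) : ℂ) - δ) / (y - 1))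
      (e := fun n => y ^ (n + 2) * (1 / ((((n + 1) + 1 : ℕ) : ℂ) - δ) * (1 / (((n + 1 : ℕ) : ℂ) - δ)))
        / (y - 1)) (K := 4 / ‖y - 1‖) ?_ ?_ ?_
    · intro n
      rw [Finset.sum_Icc_succ_top (by omega)]
      have h1 := hne n
      have h2 := hne (n + 1)
      have h3 : (((n + 1) + 1 : ℕ) : ℂ) - δ = (((n + 1 : ℕ) : ℂ) - δ) + 1 := by push_cast; ring
      rw [h3] at h2 ⊢
      field_simp
      ring
    · intro n
      rw [norm_div, norm_div, norm_pow, hy, one_pow, hnorm]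
      have := hpos n
      have hp : 0 < (n : ℝ) + 1 - δ := lt_of_lt_of_le (by positivity) this
      rw [div_div, div_div, div_le_div_iff₀ (by positivity) (by positivity)]
      nlinarith
    · intro n
      rw [norm_div, norm_mul, norm_mul, norm_div, norm_div, norm_pow, hy, one_pow, hnorm, hnorm]
      simp only [norm_one, one_mul]
      have h1 := hpos n
      have h2 := hpos (n + 1)
      have h3 : (0 : ℝ) ≤ n := by positivity
      push_cast at h2 ⊢
      rw [one_div_mul_one_div, div_div, div_div]
      have h4 : ((n : ℝ) + 1 + 1) / 2 * (((n : ℝ) + 1) / 2)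
          ≤ ((n : ℝ) + 1 + 1 - δ) * ((n : ℝ) + 1 - δ) :=
        mul_le_mul h2 h1 (by positivity) (by linarith)
      have h5 : 0 < ((n : ℝ) + 1 + 1 - δ) * ((n : ℝ) + 1 - δ) :=
        lt_of_lt_of_le (by positivity) h4
      rw [div_le_div_iff₀ (by positivity) (by positivity)]
      nlinarith
  -- For b ≥ 2 the terms are themselves O(1/n²); the last factor 2 absorbs n + 2 ≤ 2(n + 1).
  · refine exists_tail_bound (v := fun n => 0)
      (e := fun n => y ^ (n + 1) / (((n + 1 : ℕ) : ℂ) - δ) ^ b) (K := 2 ^ b * 2) ?_ ?_ ?_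
    · intro n
      rw [Finset.sum_Icc_succ_top (by omega)]
      ring
    · intro n
      rw [norm_zero]
      positivity
    · intro n
      rw [norm_div, norm_pow, norm_pow, hy, one_pow, hnorm]
      have h1 : (((n : ℝ) + 1) / 2) ^ b ≤ ((n : ℝ) + 1 - δ) ^ b :=
        pow_le_pow_left₀ (by positivity) (hpos n) b
      have h2 : ((n : ℝ) + 1) ^ 2 ≤ ((n : ℝ) + 1) ^ b :=
        pow_le_pow_right₀ (by have : (0 : ℝ) ≤ n := by positivity
                              linarith) (by omega)
      have h3 : ((n : ℝ) + 1) ^ 2 / 2 ^ b ≤ ((n : ℝ) + 1 - δ) ^ b := by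
        refine le_trans ?_ h1
        rw [div_pow]
        gcongr
      calc 1 / ((n : ℝ) + 1 - δ) ^ b ≤ 1 / (((n : ℝ) + 1) ^ 2 / 2 ^ b) :=
            one_div_le_one_div_of_le (by positivity) h3
        _ = 2 ^ b / ((n : ℝ) + 1) ^ 2 := by rw [one_div_div]
        _ ≤ 2 ^ b * 2 / (((n : ℝ) + 1) * (n + 2)) := by
            rw [div_le_div_iff₀ (by positivity) (by positivity), mul_assoc]
            refine mul_le_mul_of_nonneg_left ?_ (by positivity)
            have : (0 : ℝ) ≤ n := by positivity
            nlinarith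

lemma cycHarmonic_tail {b : ℕ} {y : ℂ} (hb : 1 ≤ b) (hy : ‖y‖ = 1) (hby : (b, y) ≠ (1, 1)) :
    ∃ (T : ℂ) (K : ℝ), ∀ n : ℕ, ‖cycHarmonic b y n - T‖ ≤ K / (n + 1) := by
  simpa [cycHarmonic] using exists_tail_bound_shift (δ := 0) (by norm_num) hb hy hby

lemma cycOddHarmonic_tail {b : ℕ} {y : ℂ} (hb : 1 ≤ b) (hy : ‖y‖ = 1) (hby : (b, y) ≠ (1, 1)) :
    ∃ (T : ℂ) (K : ℝ), ∀ n : ℕ, ‖cycOddHarmonic b y n - T‖ ≤ K / (n + 1) := by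
  simpa [cycOddHarmonic] using
    exists_tail_bound_shift (δ := 1 / 2) le_rfl hb hy hby

lemma tendsto_of_tail_bound {h : ℕ → ℂ} {T : ℂ} {K : ℝ} (H : ∀ n : ℕ, ‖h n - T‖ ≤ K / (n + 1)) :
    Tendsto h atTop (𝓝 T) := by
  rw [tendsto_iff_norm_sub_tendsto_zero]
  refine squeeze_zero (fun _ => norm_nonneg _) H ?_
  simpa [div_eq_mul_inv] using (tendsto_one_div_add_atTop_nhds_zero_nat (𝕜 := ℝ)).const_mul K

/-! ### Tame families and the interchange of limit and conditionally convergent sum. -/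

/-- `a M n` is, up to an error `O(1/(n+1) + 1/(|M-n|+1))`, constant for `n ≤ M` and
constant for `n > M`, and converges pointwise to `l` as `M → ∞`. -/
def IsTame (a : ℕ → ℕ → ℂ) (l : ℕ → ℂ) : Prop :=
  (∀ n, Tendsto (fun M => a M n) atTop (𝓝 (l n))) ∧
  ∃ (C D : ℂ) (K : ℝ), ∀ M n : ℕ, ‖a M n - if n ≤ M then C else D‖
    ≤ K * (1 / ((n : ℝ) + 1) + 1 / (|(M : ℝ) - n| + 1))

lemma tame_gauge_pos (M n : ℕ) : 0 < 1 / ((n : ℝ) + 1) + 1 / (|(M : ℝ) - n| + 1) := by positivity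

lemma tame_gauge_le (M n : ℕ) : 1 / ((n : ℝ) + 1) + 1 / (|(M : ℝ) - n| + 1) ≤ 2 := by
  have h1 : 1 / ((n : ℝ) + 1) ≤ 1 := by
    rw [div_le_one (by positivity)]
    have : (0 : ℝ) ≤ n := by positivity
    linarith
  have h2 : 1 / (|(M : ℝ) - n| + 1) ≤ 1 := by
    rw [div_le_one (by positivity)]
    have : (0 : ℝ) ≤ |(M : ℝ) - n| := by positivity
    linarith
  linarith

lemma IsTame.const (c : ℂ) : IsTame (fun _ _ => c) (fun _ => c) :=
  ⟨fun _ => tendsto_const_nhds, c, c, 0, fun M n => by simp⟩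

lemma IsTame.indicator : IsTame (fun M n => if n ≤ M then 1 else 0) (fun _ => 1) := by
  refine ⟨fun n => ?_, 1, 0, 0, fun M n => by simp⟩
  refine tendsto_const_nhds.congr' ?_
  filter_upwards [eventually_ge_atTop n] with M hM
  simp [hM]

lemma IsTame.add {a a' : ℕ → ℕ → ℂ} {l l' : ℕ → ℂ} (h : IsTame a l) (h' : IsTame a' l') :
    IsTame (fun M n => a M n + a' M n) (fun n => l n + l' n) := by
  obtain ⟨h1, C, D, K, hK⟩ := h
  obtain ⟨h1', C', D', K', hK'⟩ := h'
  refine ⟨fun n => (h1 n).add (h1' n), C + C', D + D', K + K', fun M n => ?_⟩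
  have : a M n + a' M n - (if n ≤ M then C + C' else D + D')
      = (a M n - if n ≤ M then C else D) + (a' M n - if n ≤ M then C' else D') := by
    split_ifs <;> ring
  rw [this, add_mul]
  exact (norm_add_le _ _).trans (add_le_add (hK M n) (hK' M n))

lemma IsTame.mul {a a' : ℕ → ℕ → ℂ} {l l' : ℕ → ℂ} (h : IsTame a l) (h' : IsTame a' l') :
    IsTame (fun M n => a M n * a' M n) (fun n => l n * l' n) := by
  obtain ⟨h1, C, D, K, hK⟩ := h
  obtain ⟨h1', C', D', K', hK'⟩ := h'
  refine ⟨fun n => (h1 n).mul (h1' n), C * C', D * D',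
    K * (2 * K') + K * (‖C'‖ + ‖D'‖) + (‖C‖ + ‖D‖) * K', fun M n => ?_⟩
  set g := 1 / ((n : ℝ) + 1) + 1 / (|(M : ℝ) - n| + 1) with hg
  have hg0 : 0 < g := tame_gauge_pos M n
  have hg2 : g ≤ 2 := tame_gauge_le M n
  have e1 := hK M n
  have e2 := hK' M n
  set c := (if n ≤ M then C else D) with hc
  set c' := (if n ≤ M then C' else D') with hc'
  have hcb : ‖c‖ ≤ ‖C‖ + ‖D‖ := by
    rw [hc]; split_ifs <;> linarith [norm_nonneg C, norm_nonneg D]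
  have hcb' : ‖c'‖ ≤ ‖C'‖ + ‖D'‖ := by
    rw [hc']; split_ifs <;> linarith [norm_nonneg C', norm_nonneg D']
  have : a M n * a' M n - (if n ≤ M then C * C' else D * D')
      = (a M n - c) * (a' M n - c') + (a M n - c) * c' + c * (a' M n - c') := by
    rw [hc, hc']; split_ifs <;> ring
  rw [this, add_mul, add_mul]
  have hKg : 0 ≤ K * g := (norm_nonneg _).trans e1
  have hK0 : 0 ≤ K' := by
    by_contra hneg
    have := (norm_nonneg _).trans e2
    nlinarith
  refine (norm_add₃_le).trans (add_le_add (add_le_add ?_ ?_) ?_)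
  · rw [norm_mul]
    calc _ ≤ (K * g) * (K' * g) := mul_le_mul e1 e2 (norm_nonneg _) hKg
      _ ≤ (K * g) * (K' * 2) := by gcongr
      _ = _ := by ring
  · rw [norm_mul]
    calc _ ≤ (K * g) * (‖C'‖ + ‖D'‖) := mul_le_mul e1 hcb' (norm_nonneg _) hKg
      _ = _ := by ring
  · rw [norm_mul, mul_assoc]
    exact mul_le_mul hcb e2 (norm_nonneg _) (by positivity)

lemma IsTame.prod {ι : Type*} (s : Finset ι) {a : ι → ℕ → ℕ → ℂ} {l : ι → ℕ → ℂ}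
    (h : ∀ i ∈ s, IsTame (a i) (l i)) :
    IsTame (fun M n => ∏ i ∈ s, a i M n) (fun n => ∏ i ∈ s, l i n) := by
  classical
  induction s using Finset.induction_on with
  | empty => simpa using IsTame.const 1
  | insert i s hi ih =>
    simp only [Finset.prod_insert hi]
    exact (h i (by simp)).mul (ih fun j hj => h j (by simp [hj]))

lemma IsTame.of_tail {h : ℕ → ℂ} {T : ℂ} {K : ℝ} (H : ∀ n : ℕ, ‖h n - T‖ ≤ K / (n + 1)) :
    IsTame (fun _ n => h n) h := by
  refine ⟨fun n => tendsto_const_nhds, T, T, K, fun M n => ?_⟩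
  have hK : 0 ≤ K := by simpa using (norm_nonneg _).trans (H 0)
  simp only [ite_self]
  refine (H n).trans ?_
  rw [mul_add, mul_one_div]
  have : 0 ≤ K * (1 / (|(M : ℝ) - n| + 1)) := by positivity
  linarith

/-- Truncated subtraction makes the family equal to h 0 for n > M, which is why the second constant
is h 0. -/
lemma IsTame.of_tail_sub {h : ℕ → ℂ} {T : ℂ} {K : ℝ} (H : ∀ n : ℕ, ‖h n - T‖ ≤ K / (n + 1)) :
    IsTame (fun M n => h (M - n)) (fun _ => T) := by
  have hK : 0 ≤ K := by simpa using (norm_nonneg _).trans (H 0)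
  refine ⟨fun n => (tendsto_of_tail_bound H).comp (tendsto_sub_atTop_nat n), T, h 0, K,
    fun M n => ?_⟩
  split_ifs with hn
  · refine (H _).trans ?_
    rw [Nat.cast_sub hn, abs_of_nonneg (by simpa using hn), mul_add, mul_one_div, mul_one_div]
    have : 0 ≤ K / ((n : ℝ) + 1) := by positivity
    linarith
  · simp only [Nat.sub_eq_zero_of_le (le_of_not_ge hn), sub_self, norm_zero]
    positivity

/-- Write 1/(ab) = (ab)^(-1/4) (ab)^(-3/4). The first factor is controlled by ab ≥ (a + b)/2, the
second by the inequality between arithmetic and geometric means. The exponent 3/2 > 1 leaves a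
summable series, and the power -1/4 gives decay in a + b. -/
lemma inv_mul_le_rpow {a b : ℝ} (ha : 1 ≤ a) (hb : 1 ≤ b) :
    1 / (a * b) ≤ ((a + b) / 2) ^ (-(1 / 4) : ℝ) *
      (1 / a ^ (3 / 2 : ℝ) + 1 / b ^ (3 / 2 : ℝ)) := by
  have ha0 : 0 < a := by linarith
  have hb0 : 0 < b := by linarith
  have hab : (a + b) / 2 ≤ a * b := by nlinarith
  have h1 : 1 / (a * b) = (a * b) ^ (-(1 / 4) : ℝ) * (a ^ (-(3 / 4) : ℝ) * b ^ (-(3 / 4) : ℝ)) := by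
    rw [← Real.mul_rpow ha0.le hb0.le, ← Real.rpow_add (by positivity), one_div,
      ← Real.rpow_neg_one]
    norm_num
  have h2 : ∀ c : ℝ, 0 < c → 1 / c ^ (3 / 2 : ℝ) = c ^ (-(3 / 4) : ℝ) * c ^ (-(3 / 4) : ℝ) := by
    intro c hc
    rw [← Real.rpow_add hc, one_div, ← Real.rpow_neg hc.le]
    norm_num
  rw [h1, h2 a ha0, h2 b hb0]
  refine mul_le_mul (Real.rpow_le_rpow_of_nonpos (by positivity) hab (by norm_num)) ?_
    (by positivity) (by positivity)
  nlinarith [sq_nonneg (a ^ (-(3 / 4) : ℝ) - b ^ (-(3 / 4) : ℝ)),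
    mul_self_nonneg (a ^ (-(3 / 4) : ℝ)), mul_self_nonneg (b ^ (-(3 / 4) : ℝ))]

lemma summable_int_abs_add_one :
    Summable (fun m : ℤ => 1 / (|(m : ℝ)| + 1) ^ (3 / 2 : ℝ)) := by
  refine Summable.of_nonneg_of_le (fun m => by positivity) (fun m => ?_)
    ((Real.summable_one_div_int_add_rpow (1 / 2) (3 / 2)).2 (by norm_num))
  have h0 : 0 < |(m : ℝ) + 1 / 2| := by
    rw [abs_pos]
    intro h
    have h2 : (2 * m + 1 : ℝ) = 0 := by linarith
    have h3 : 2 * m + 1 = 0 := by exact_mod_cast h2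
    omega
  refine one_div_le_one_div_of_le (by positivity) (Real.rpow_le_rpow h0.le ?_ (by norm_num))
  refine (abs_add_le _ _).trans ?_
  rw [abs_of_pos (by norm_num : (0 : ℝ) < 1 / 2)]
  linarith

lemma summable_tame_error (M : ℕ) :
    Summable (fun n : ℕ => 1 / (((n : ℝ) + 1) * (|(M : ℝ) - n| + 1))) := by
  have hF := summable_int_abs_add_one
  have i1 : Function.Injective (fun n : ℕ => (n : ℤ)) := Nat.cast_injective
  have i2 : Function.Injective (fun n : ℕ => (M : ℤ) - n) := fun a b h => by simpa using h
  refine Summable.of_nonneg_of_le (fun n => by positivity) (fun n => ?_)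
    (((hF.comp_injective i1).add (hF.comp_injective i2)).mul_left (1 : ℝ))
  refine (inv_mul_le_rpow (by simp) (by simp)).trans ?_
  have h1 : (((n : ℝ) + 1 + (|(M : ℝ) - n| + 1)) / 2) ^ (-(1 / 4) : ℝ) ≤ 1 := by
    refine Real.rpow_le_one_of_one_le_of_nonpos ?_ (by norm_num)
    have : (0 : ℝ) ≤ n := by positivity
    have := abs_nonneg ((M : ℝ) - n)
    linarith
  simp only [Function.comp, Int.cast_natCast, Int.cast_sub, Nat.abs_cast]
  gcongr

/-- In `inv_mul_le_rpow` take a = n + 1 and b = |M - n| + 1. Then a + b ≥ M + 2, so a factor ((M +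
2)/2)^(-1/4) comes out, and the rest is bounded by two copies of one convergent series over ℤ,
through the embeddings n ↦ n and n ↦ M - n. -/
lemma tendsto_tsum_tame_error :
    Tendsto (fun M : ℕ => ∑' n : ℕ, 1 / (((n : ℝ) + 1) * (|(M : ℝ) - n| + 1))) atTop (𝓝 0) := by
  have hF := summable_int_abs_add_one
  set Z := ∑' m : ℤ, 1 / (|(m : ℝ)| + 1) ^ (3 / 2 : ℝ) with hZ
  have hFnn : ∀ m : ℤ, 0 ≤ 1 / (|(m : ℝ)| + 1) ^ (3 / 2 : ℝ) := fun m => by positivity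
  have i1 : Function.Injective (fun n : ℕ => (n : ℤ)) := Nat.cast_injective
  have bound : ∀ M : ℕ, ∑' n : ℕ, 1 / (((n : ℝ) + 1) * (|(M : ℝ) - n| + 1))
      ≤ (((M : ℝ) + 2) / 2) ^ (-(1 / 4) : ℝ) * (Z + Z) := by
    intro M
    have i2 : Function.Injective (fun n : ℕ => (M : ℤ) - n) := fun a b h => by simpa using h
    have s1 := hF.comp_injective i1
    have s2 := hF.comp_injective i2
    have t1 := tsum_comp_le_tsum_of_inj hF hFnn i1
    have t2 := tsum_comp_le_tsum_of_inj hF hFnn i2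
    refine le_trans (Summable.tsum_le_tsum (fun n => ?_) (summable_tame_error M)
      ((s1.add s2).mul_left ((((M : ℝ) + 2) / 2) ^ (-(1 / 4) : ℝ)))) ?_
    · refine (inv_mul_le_rpow (by simp) (by simp)).trans ?_
      have h1 : (((n : ℝ) + 1 + (|(M : ℝ) - n| + 1)) / 2) ^ (-(1 / 4) : ℝ)
          ≤ (((M : ℝ) + 2) / 2) ^ (-(1 / 4) : ℝ) := by
        refine Real.rpow_le_rpow_of_nonpos (by positivity) ?_ (by norm_num)
        have := le_abs_self ((M : ℝ) - n)
        linarith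
      simp only [Function.comp, Int.cast_natCast, Int.cast_sub, Nat.abs_cast]
      gcongr
    · rw [tsum_mul_left, s1.tsum_add s2]
      gcongr
  refine squeeze_zero (fun M => tsum_nonneg fun n => by positivity) bound ?_
  rw [← zero_mul (Z + Z)]
  refine Tendsto.mul_const _ ?_
  refine (tendsto_rpow_neg_atTop (by norm_num : (0 : ℝ) < 1 / 4)).comp ?_
  exact (tendsto_atTop_add_const_right _ _ tendsto_natCast_atTop_atTop).atTop_div_const (by norm_num)

/-- Dominated convergence with an extra majorant q M that moves with M but whose total mass tends to
0. The usual theorem is applied to the positive part of ‖f M n‖ - q M n, which is dominated by p. -/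
lemma tendsto_tsum_of_split_bound {f : ℕ → ℕ → ℂ} {p : ℕ → ℝ} {q : ℕ → ℕ → ℝ}
    (hf : ∀ n, Tendsto (fun M => f M n) atTop (𝓝 0)) (hp : Summable p)
    (hq : ∀ M, Summable (q M)) (hq0 : ∀ M n, 0 ≤ q M n)
    (hqt : Tendsto (fun M => ∑' n, q M n) atTop (𝓝 0))
    (hb : ∀ M n, ‖f M n‖ ≤ p n + q M n) (hp0 : ∀ n, 0 ≤ p n) :
    Tendsto (fun M => ∑' n, f M n) atTop (𝓝 0) := by
  have h1 : Tendsto (fun M => ∑' n, max (‖f M n‖ - q M n) 0) atTop (𝓝 (∑' _ : ℕ, (0 : ℝ))) := by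
    refine tendsto_tsum_of_dominated_convergence hp (fun n => ?_) (Eventually.of_forall fun M n => ?_)
    · refine squeeze_zero (fun M => le_max_right _ _) (fun M => ?_) (tendsto_norm_zero.comp (hf n))
      exact max_le (by have := hq0 M n; simp only [Function.comp]; linarith) (norm_nonneg _)
    · rw [Real.norm_of_nonneg (le_max_right _ _)]
      exact max_le (by linarith [hb M n]) (hp0 n)
  rw [tsum_zero] at h1
  have h2 := h1.add hqt
  rw [add_zero] at h2
  have hs : ∀ M, Summable (fun n => max (‖f M n‖ - q M n) 0) := fun M =>
    Summable.of_nonneg_of_le (fun n => le_max_right _ _)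
      (fun n => max_le (by linarith [hb M n]) (hp0 n)) hp
  refine squeeze_zero_norm (fun M => ?_) h2
  have hfs : Summable (fun n => ‖f M n‖) :=
    Summable.of_nonneg_of_le (fun n => norm_nonneg _) (hb M) (hp.add (hq M))
  refine (norm_tsum_le_tsum_norm hfs).trans ?_
  rw [← (hs M).tsum_add (hq M)]
  exact Summable.tsum_le_tsum (fun n => by linarith [le_max_left (‖f M n‖ - q M n) 0]) hfs
    ((hs M).add (hq M))

/-- Split the tame family into its step function and its error. The step function only meets partial
sums and tails of ∑ w, so conditional convergence suffices there, and the constant D disappears with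
the tails. The error times w is absolutely summable, by 1/(n + 1)² and the mass bounded in
`tendsto_tsum_tame_error`. -/
lemma IsTame.tendsto_sum {a : ℕ → ℕ → ℂ} {l w : ℕ → ℂ} {W : ℂ} {κ : ℝ} (h : IsTame a l)
    (hW : Tendsto (fun N => ∑ n ∈ Finset.range N, w n) atTop (𝓝 W))
    (hw : ∀ n : ℕ, ‖w n‖ ≤ κ / (n + 1)) :
    ∃ (S : ℕ → ℂ) (S' : ℂ),
      (∀ M, Tendsto (fun N => ∑ n ∈ Finset.range N, w n * a M n) atTop (𝓝 (S M))) ∧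
      Tendsto S atTop (𝓝 S') ∧
      Tendsto (fun N => ∑ n ∈ Finset.range N, w n * l n) atTop (𝓝 S') := by
  obtain ⟨hl, C, D, K, hK⟩ := h
  have hκ : 0 ≤ κ := by simpa using (norm_nonneg _).trans (hw 0)
  have hK0 : 0 ≤ K := by
    have := (norm_nonneg _).trans (hK 0 0)
    have h2 := tame_gauge_pos 0 0
    by_contra hneg
    nlinarith
  set e : ℕ → ℕ → ℂ := fun M n => a M n - if n ≤ M then C else D with he
  set e' : ℕ → ℂ := fun n => l n - C with he'
  have hlim : ∀ n, Tendsto (fun M => e M n) atTop (𝓝 (e' n)) := by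
    intro n
    refine ((hl n).sub_const C).congr' ?_
    filter_upwards [eventually_ge_atTop n] with M hM
    simp [he, hM]
  have he'b : ∀ n : ℕ, ‖e' n‖ ≤ K * (1 / ((n : ℝ) + 1)) := by
    intro n
    have h1 : Tendsto (fun M : ℕ => |(M : ℝ) - n| + 1) atTop atTop := by
      refine tendsto_atTop_add_const_right _ _ (tendsto_abs_atTop_atTop.comp ?_)
      exact tendsto_atTop_add_const_right _ _ tendsto_natCast_atTop_atTop
    have h2 : Tendsto (fun M : ℕ => K * (1 / ((n : ℝ) + 1) + 1 / (|(M : ℝ) - n| + 1))) atTop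
        (𝓝 (K * (1 / ((n : ℝ) + 1) + 0))) :=
      ((tendsto_const_nhds.div_atTop h1).const_add _).const_mul _
    rw [add_zero] at h2
    exact le_of_tendsto_of_tendsto (hlim n).norm h2 (Eventually.of_forall fun M => hK M n)
  have hp : Summable (fun n : ℕ => 1 / (((n : ℝ) + 1) * ((n : ℝ) + 1))) := by
    have := (summable_nat_add_iff 1).2 (Real.summable_one_div_nat_pow.2 (by norm_num : 1 < 2))
    refine this.congr fun n => ?_
    push_cast
    rw [sq]
  have heb : ∀ M n : ℕ, ‖w n * e M n‖ ≤ κ * K * (1 / (((n : ℝ) + 1) * ((n : ℝ) + 1)))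
      + κ * K * (1 / (((n : ℝ) + 1) * (|(M : ℝ) - n| + 1))) := by
    intro M n
    rw [norm_mul]
    refine (mul_le_mul (hw n) (hK M n) (norm_nonneg _) (by positivity)).trans (le_of_eq ?_)
    field_simp
  have hweb : ∀ n : ℕ, ‖w n * e' n‖ ≤ κ * K * (1 / (((n : ℝ) + 1) * ((n : ℝ) + 1))) := by
    intro n
    rw [norm_mul]
    refine (mul_le_mul (hw n) (he'b n) (norm_nonneg _) (by positivity)).trans (le_of_eq ?_)
    field_simp
  have s1 : ∀ M, Summable (fun n => w n * e M n) := fun M =>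
    Summable.of_norm_bounded ((hp.mul_left _).add ((summable_tame_error M).mul_left _)) (heb M)
  have s2 : Summable (fun n => w n * e' n) := Summable.of_norm_bounded (hp.mul_left _) hweb
  set P : ℕ → ℂ := fun N => ∑ n ∈ Finset.range N, w n with hP
  have hstep : ∀ M, Tendsto (fun N => ∑ n ∈ Finset.range N, w n * (if n ≤ M then C else D)) atTop
      (𝓝 (P (M + 1) * C + (W - P (M + 1)) * D)) := by
    intro M
    refine (((hW.sub_const (P (M + 1))).mul_const D).const_add (P (M + 1) * C)).congr' ?_
    filter_upwards [eventually_ge_atTop (M + 1)] with N hN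
    obtain ⟨d, rfl⟩ := Nat.exists_eq_add_of_le hN
    have hPd : P (M + 1 + d) = P (M + 1) + ∑ n ∈ Finset.range d, w (M + 1 + n) :=
      Finset.sum_range_add _ _ _
    rw [hPd, add_sub_cancel_left, Finset.sum_range_add _ (M + 1) d]
    congr 1
    · rw [hP, Finset.sum_mul]
      refine Finset.sum_congr rfl fun n hn => ?_
      rw [if_pos (by simpa [Nat.lt_succ_iff] using hn)]
    · rw [Finset.sum_mul]
      refine Finset.sum_congr rfl fun n hn => ?_
      rw [if_neg (by omega)]
  refine ⟨fun M => P (M + 1) * C + (W - P (M + 1)) * D + ∑' n, w n * e M n,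
    W * C + ∑' n, w n * e' n, fun M => ?_, ?_, ?_⟩
  · refine ((hstep M).add (s1 M).hasSum.tendsto_sum_nat).congr fun N => ?_
    rw [← Finset.sum_add_distrib]
    refine Finset.sum_congr rfl fun n _ => ?_
    simp only [he]
    ring
  · have hW1 : Tendsto (fun M => P (M + 1)) atTop (𝓝 W) := hW.comp (tendsto_add_atTop_nat 1)
    have h1 : Tendsto (fun M => P (M + 1) * C + (W - P (M + 1)) * D) atTop (𝓝 (W * C)) := by
      have := (hW1.mul_const C).add ((hW1.const_sub W).mul_const D)
      simpa using this
    refine h1.add ?_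
    have h2 : Tendsto (fun M => ∑' n, (w n * e M n - w n * e' n)) atTop (𝓝 0) := by
      refine tendsto_tsum_of_split_bound
        (p := fun n => κ * K * (1 / (((n : ℝ) + 1) * ((n : ℝ) + 1))) +
          κ * K * (1 / (((n : ℝ) + 1) * ((n : ℝ) + 1))))
        (q := fun M n => κ * K * (1 / (((n : ℝ) + 1) * (|(M : ℝ) - n| + 1))))
        (fun n => ?_) ((hp.mul_left _).add (hp.mul_left _))
        (fun M => (summable_tame_error M).mul_left _) (fun M n => by positivity) ?_
        (fun M n => ?_) (fun n => by positivity)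
      · have := ((hlim n).const_mul (w n)).sub_const (w n * e' n)
        simpa using this
      · simp only [tsum_mul_left]
        simpa using tendsto_tsum_tame_error.const_mul (κ * K)
      · refine (norm_sub_le _ _).trans ?_
        linarith [heb M n, hweb n]
    have h3 := h2.add_const (∑' n, w n * e' n)
    rw [zero_add] at h3
    refine h3.congr fun M => ?_
    rw [(s1 M).tsum_sub s2, sub_add_cancel]
  · refine ((hW.mul_const C).add s2.hasSum.tendsto_sum_nat).congr fun N => ?_
    rw [Finset.sum_mul, ← Finset.sum_add_distrib]
    refine Finset.sum_congr rfl fun n _ => ?_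
    simp only [he']
    ring

/-! ### Partial fractions through Laurent expansions. -/

section PartialFractions

variable {K : Type*} [Field K]

/-- The Taylor expansion of `(X + c)⁻ᵖ` at `X = 0`, for `p ≥ 1`. -/
noncomputable def invPowSeries (p : ℕ) (c : K) : PowerSeries K :=
  PowerSeries.mk fun l => (-1) ^ l * (((p - 1 + l).choose (p - 1) : ℕ) : K) * (c ^ (p + l))⁻¹

/-- The geometric series in -X/c inverts X + c; its powers have the negative binomial coefficients.
-/
lemma single_add_C_inv_pow {p : ℕ} (hp : 1 ≤ p) {c : K} (hc : c ≠ 0) :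
    ((HahnSeries.single 1 1 + HahnSeries.C c : LaurentSeries K)⁻¹) ^ p
      = HahnSeries.ofPowerSeries ℤ K (invPowSeries p c) := by
  obtain ⟨d, rfl⟩ := Nat.exists_eq_add_of_le' hp
  set g : PowerSeries K := PowerSeries.C c⁻¹ * PowerSeries.rescale (-c⁻¹) (PowerSeries.mk 1) with hg
  have h1 : g * (PowerSeries.X + PowerSeries.C c) = 1 := by
    have h := congrArg (PowerSeries.rescale (-c⁻¹)) (PowerSeries.mk_one_mul_one_sub_eq_one K)
    rw [map_mul, map_sub, map_one, PowerSeries.rescale_X] at h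
    rw [hg, ← h, mul_right_comm, mul_comm]
    congr 1
    rw [mul_add, ← map_mul, inv_mul_cancel₀ hc, map_neg, map_one]
    ring
  have h2 : (HahnSeries.single 1 1 + HahnSeries.C c : LaurentSeries K)⁻¹
      = HahnSeries.ofPowerSeries ℤ K g := by
    refine inv_eq_of_mul_eq_one_left ?_
    have := congrArg (HahnSeries.ofPowerSeries ℤ K) h1
    rw [map_mul, map_add, map_one] at this
    simpa using this
  rw [h2, ← map_pow]
  congr 1
  rw [hg, mul_pow, ← map_pow, ← map_pow, PowerSeries.mk_one_pow_eq_mk_choose_add]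
  ext l
  rw [PowerSeries.coeff_C_mul, PowerSeries.coeff_rescale, PowerSeries.coeff_mk, invPowSeries,
    PowerSeries.coeff_mk, neg_pow, ← inv_pow]
  simp only [Nat.add_sub_cancel]
  ring

/-- The function `1 / (s - a)`, recorded by its value at `m` and its Laurent expansions at all
points of the plane. -/
noncomputable def poleElt (m a : K) : K × (K → LaurentSeries K) :=
  ((m - a)⁻¹, fun b => (HahnSeries.single 1 1 + HahnSeries.C (b - a))⁻¹)

lemma single_add_C_ne_zero (c : K) :
    (HahnSeries.single 1 1 + HahnSeries.C c : LaurentSeries K) ≠ 0 := by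
  intro h
  have := congrArg (fun f : LaurentSeries K => f.coeff 1) h
  simp [HahnSeries.C_apply, HahnSeries.coeff_single_of_ne] at this

/-- Constant functions, recorded in the same way. -/
noncomputable def constElt (c : K) : K × (K → LaurentSeries K) :=
  (c, fun _ => HahnSeries.C c)

lemma constElt_mul (c d : K) : constElt (c * d) = constElt c * constElt d :=
  Prod.ext rfl (funext fun _ => map_mul HahnSeries.C c d)

lemma constElt_one : constElt (1 : K) = 1 := rfl

/-- The two-pole identity 1/((s - a)(s - b)) = (1/(s - a) - 1/(s - b))/(a - b), checked at the value
and in every expansion at once. The value requires m to differ from both poles because inversion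
sends 0 to 0. -/
lemma poleElt_mul_poleElt {m a b : K} (hab : a ≠ b) (ha : m ≠ a) (hb : m ≠ b) :
    poleElt m a * poleElt m b = constElt (a - b)⁻¹ * (poleElt m a - poleElt m b) := by
  have hab' := sub_ne_zero.2 hab
  refine Prod.ext ?_ ?_
  · have h1 := sub_ne_zero.2 ha
    have h2 := sub_ne_zero.2 hb
    simp only [poleElt, constElt, Prod.fst_mul, Prod.fst_sub]
    field_simp
    ring
  · funext z
    simp only [poleElt, constElt, Prod.snd_mul, Prod.snd_sub, Pi.mul_apply, Pi.sub_apply]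
    have h1 := single_add_C_ne_zero (z - a)
    have h2 := single_add_C_ne_zero (z - b)
    rw [inv_sub_inv h1 h2, ← mul_inv]
    have h3 : (HahnSeries.single 1 1 + HahnSeries.C (z - b) : LaurentSeries K)
        - (HahnSeries.single 1 1 + HahnSeries.C (z - a)) = HahnSeries.C (a - b) := by
      rw [add_sub_add_left_eq_sub, ← map_sub]
      congr 1
      ring
    rw [h3, mul_div_assoc', ← RingHom.map_mul, inv_mul_cancel₀ hab', RingHom.map_one, one_div]

/-- The span of the functions `(s - a)⁻ⁱ`, `i ≥ 1`, `a ∈ s`. -/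
noncomputable def polesSpan (m : K) (s : Finset K) : AddSubgroup (K × (K → LaurentSeries K)) :=
  AddSubgroup.closure {v | ∃ a ∈ s, ∃ (i : ℕ) (c : K), v = constElt c * poleElt m a ^ (i + 1)}

lemma constElt_mul_mem {m : K} {s : Finset K} (c : K) {v : K × (K → LaurentSeries K)}
    (hv : v ∈ polesSpan m s) : constElt c * v ∈ polesSpan m s := by
  induction hv using AddSubgroup.closure_induction with
  | mem v hv =>
    obtain ⟨a, ha, i, d, rfl⟩ := hv
    rw [← mul_assoc, ← constElt_mul]
    exact AddSubgroup.subset_closure ⟨a, ha, i, _, rfl⟩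
  | zero => rw [mul_zero]; exact zero_mem _
  | add v w _ _ hv hw => rw [mul_add]; exact add_mem hv hw
  | neg v _ hv => rw [mul_neg]; exact neg_mem hv

lemma poleElt_pow_mem {m : K} {s : Finset K} {a : K} (ha : a ∈ s) {i : ℕ} (hi : 1 ≤ i) :
    poleElt m a ^ i ∈ polesSpan m s := by
  obtain ⟨j, rfl⟩ := Nat.exists_eq_add_of_le' hi
  exact AddSubgroup.subset_closure ⟨a, ha, j, 1, by rw [constElt_one, one_mul]⟩

/-- Each use of `poleElt_mul_poleElt` lowers i + j by one, hence the induction on the total order.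
-/
lemma poleElt_pow_mul_pow_mem {m : K} {s : Finset K} (hm : m ∉ s) {a b : K} (ha : a ∈ s)
    (hb : b ∈ s) (hab : a ≠ b) (N : ℕ) : ∀ i j : ℕ, i + j = N → 1 ≤ i + j →
      poleElt m a ^ i * poleElt m b ^ j ∈ polesSpan m s := by
  induction N with
  | zero => intro i j h h'; omega
  | succ N ih =>
    intro i j h _
    rcases Nat.eq_zero_or_pos i with rfl | hi
    · rw [pow_zero, one_mul]
      exact poleElt_pow_mem hb (by omega)
    rcases Nat.eq_zero_or_pos j with rfl | hj
    · rw [pow_zero, mul_one]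
      exact poleElt_pow_mem ha (by omega)
    obtain ⟨i, rfl⟩ := Nat.exists_eq_add_of_le' hi
    obtain ⟨j, rfl⟩ := Nat.exists_eq_add_of_le' hj
    have h1 : poleElt m a ^ (i + 1) * poleElt m b ^ (j + 1) = constElt (a - b)⁻¹ *
        (poleElt m a ^ (i + 1) * poleElt m b ^ j - poleElt m a ^ i * poleElt m b ^ (j + 1)) := by
      have h2 := poleElt_mul_poleElt (m := m) hab (fun h => hm (h ▸ ha)) (fun h => hm (h ▸ hb))
      calc _ = (poleElt m a ^ i * poleElt m b ^ j) * (poleElt m a * poleElt m b) := by ring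
        _ = _ := by
          rw [h2]
          ring
    rw [h1]
    exact constElt_mul_mem _ (sub_mem (ih _ _ (by omega) (by omega))
      (ih _ _ (by omega) (by omega)))

lemma polesSpan_mul_mem {m : K} {s : Finset K} (hm : m ∉ s) {v w : K × (K → LaurentSeries K)}
    (hv : v ∈ polesSpan m s) (hw : w ∈ polesSpan m s) : v * w ∈ polesSpan m s := by
  induction hv using AddSubgroup.closure_induction with
  | mem v hv =>
    obtain ⟨a, ha, i, c, rfl⟩ := hv
    rw [mul_assoc]
    refine constElt_mul_mem _ ?_
    induction hw using AddSubgroup.closure_induction with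
    | mem w hw =>
      obtain ⟨b, hb, j, d, rfl⟩ := hw
      rw [mul_left_comm]
      refine constElt_mul_mem _ ?_
      by_cases hab : a = b
      · subst hab
        rw [← pow_add]
        exact poleElt_pow_mem ha (by omega)
      · exact poleElt_pow_mul_pow_mem hm ha hb hab _ _ _ rfl (by omega)
    | zero => rw [mul_zero]; exact zero_mem _
    | add v w _ _ hv hw => rw [mul_add]; exact add_mem hv hw
    | neg v _ hv => rw [mul_neg]; exact neg_mem hv
  | zero => rw [zero_mul]; exact zero_mem _
  | add v w _ _ hv hw => rw [add_mul]; exact add_mem hv hw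
  | neg v _ hv => rw [neg_mul]; exact neg_mem hv

lemma ofPowerSeries_coeff_neg (f : PowerSeries K) (i : ℕ) :
    (HahnSeries.ofPowerSeries ℤ K f).coeff (-((i : ℤ) + 1)) = 0 := by
  have := PowerSeries.coeff_coe f (-((i : ℤ) + 1))
  rw [if_pos (by omega)] at this
  exact this

/-- A linear combination of the functions `(s - a)⁻ⁱ` is the sum of its principal parts. -/
lemma eq_sum_principal_parts {m : K} {s : Finset K} {v : K × (K → LaurentSeries K)}
    -- The orders of the poles are not recorded in the span; asking for every large cutoff `B` makes
    -- the claim additive. There is no polynomial part, since every generator has negative degree.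
    (hv : v ∈ polesSpan m s) : ∃ B₀ : ℕ, ∀ B ≥ B₀, v.1 = ∑ a ∈ s, ∑ i ∈ Finset.range B,
      (v.2 a).coeff (-((i : ℤ) + 1)) * ((m - a)⁻¹) ^ (i + 1) := by
  induction hv using AddSubgroup.closure_induction with
  | mem v hv =>
    obtain ⟨a, ha, j, c, rfl⟩ := hv
    refine ⟨j + 1, fun B hB => ?_⟩
    rw [Finset.sum_eq_single_of_mem a ha]
    · have h1 : (constElt c * poleElt m a ^ (j + 1)).2 a
          = HahnSeries.single (-((j : ℤ) + 1)) c := by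
        simp only [poleElt, constElt, Prod.pow_snd, Prod.snd_mul, Pi.mul_apply, Pi.pow_apply,
          sub_self, map_zero, add_zero]
        rw [HahnSeries.inv_single, HahnSeries.single_pow, HahnSeries.C_apply,
          HahnSeries.single_mul_single]
        simp
      rw [h1, Finset.sum_eq_single_of_mem j (Finset.mem_range.2 (by omega))]
      · simp [poleElt, constElt]
      · intro i _ hij
        rw [HahnSeries.coeff_single_of_ne (by omega), zero_mul]
    · intro b _ hb
      refine Finset.sum_eq_zero fun i _ => ?_
      simp only [poleElt, constElt, Prod.pow_snd, Prod.snd_mul, Pi.mul_apply, Pi.pow_apply]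
      rw [single_add_C_inv_pow (by omega) (sub_ne_zero.2 hb), HahnSeries.C_mul_eq_smul,
        HahnSeries.coeff_smul, ofPowerSeries_coeff_neg, smul_zero, zero_mul]
  | zero => exact ⟨0, fun B _ => by simp⟩
  | add v w _ _ hv hw =>
    obtain ⟨B₁, h1⟩ := hv
    obtain ⟨B₂, h2⟩ := hw
    refine ⟨max B₁ B₂, fun B hB => ?_⟩
    rw [Prod.fst_add, h1 B (le_trans (le_max_left _ _) hB), h2 B (le_trans (le_max_right _ _) hB)]
    simp only [Prod.snd_add, Pi.add_apply, HahnSeries.coeff_add, add_mul, Finset.sum_add_distrib]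
  | neg v _ hv =>
    obtain ⟨B₁, h1⟩ := hv
    refine ⟨B₁, fun B hB => ?_⟩
    rw [Prod.fst_neg, h1 B hB]
    simp only [Prod.snd_neg, Pi.neg_apply, HahnSeries.coeff_neg, neg_mul, Finset.sum_neg_distrib]

/-- The principal part of X^(-Q) f uses only the coefficients of f below degree Q; a larger cutoff
adds zeros. -/
lemma sum_single_mul_coeff (Q B : ℕ) (hB : Q ≤ B) (f : PowerSeries K) (z : K) :
    ∑ i ∈ Finset.range B, (HahnSeries.single (-(Q : ℤ)) (1 : K) *
      HahnSeries.ofPowerSeries ℤ K f).coeff (-((i : ℤ) + 1)) * z ^ (i + 1)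
    = ∑ i ∈ Finset.range Q, PowerSeries.coeff (Q - 1 - i) f * z ^ (i + 1) := by
  rw [← Finset.sum_subset (Finset.range_subset_range.2 hB)]
  · refine Finset.sum_congr rfl fun i hi => ?_
    rw [Finset.mem_range] at hi
    have h1 : (-((i : ℤ) + 1)) = -(Q : ℤ) + ((Q - 1 - i : ℕ) : ℤ) := by omega
    rw [h1, add_comm (-(Q : ℤ)), HahnSeries.coeff_single_mul_add, one_mul]
    congr 1
    exact LaurentSeries.coeff_coe_powerSeries f _
  · intro i _ hi
    rw [Finset.mem_range, not_lt] at hi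
    have h1 : (-((i : ℤ) + 1)) = (-(((i - Q : ℕ) : ℤ) + 1)) + -(Q : ℤ) := by omega
    rw [h1, HahnSeries.coeff_single_mul_add, ofPowerSeries_coeff_neg]
    simp

end PartialFractions

/-! ### The partial fraction expansion of the kernel. -/

section PartialFractionFormula

variable {K : Type*} [Field K] {ι : Type*} [Fintype ι]

lemma prod_single_neg (p : ι → ℕ) :
    ∏ j, (HahnSeries.single (-(p j : ℤ)) (1 : K) : LaurentSeries K)
      = HahnSeries.single (-((∑ j, p j : ℕ) : ℤ)) 1 := by
  classical
  have : ∀ s : Finset ι, ∏ j ∈ s, (HahnSeries.single (-(p j : ℤ)) (1 : K) : LaurentSeries K)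
      = HahnSeries.single (-((∑ j ∈ s, p j : ℕ) : ℤ)) 1 := by
    intro s
    induction s using Finset.induction_on with
    | empty => simp
    | insert i s hi ih =>
      rw [Finset.prod_insert hi, Finset.sum_insert hi, ih, HahnSeries.single_mul_single,
        one_mul, Nat.cast_add, neg_add]
  exact this _

/-- The Laurent expansion of `∑ₖ yᵏ / (s + aₖ)ᵖ` at the pole `-aₙ`. -/
lemma laurent_sum_at_pole {M n p : ℕ} (hp : 1 ≤ p) (hn : n ∈ Finset.range (M + 1)) {y : K}
    (hy : y ≠ 0) {a : ℕ → K} (ha : Function.Injective a) :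
    ∑ k ∈ Finset.range (M + 1), HahnSeries.C (y ^ k) *
      ((HahnSeries.single 1 1 + HahnSeries.C (-(a n) - -(a k)) : LaurentSeries K)⁻¹) ^ p
    = HahnSeries.single (-(p : ℤ)) 1 * HahnSeries.ofPowerSeries ℤ K (PowerSeries.C (y ^ n) *
      (1 + PowerSeries.X ^ p * ∑ k ∈ (Finset.range (M + 1)).erase n,
        PowerSeries.C (y ^ k / y ^ n) * invPowSeries p (a k - a n))) := by
  have hyn : y ^ n ≠ 0 := pow_ne_zero _ hy
  -- Only the term k = n is singular at this pole; the others are expanded as power series.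
  rw [← Finset.add_sum_erase _ _ hn, mul_add, map_add, mul_add, mul_one]
  congr 1
  · rw [sub_self, map_zero, add_zero, HahnSeries.inv_single, HahnSeries.single_pow,
      HahnSeries.ofPowerSeries_C, mul_comm]
    simp
  · have h1 : (HahnSeries.single (-(p : ℤ)) (1 : K) : LaurentSeries K) *
        HahnSeries.ofPowerSeries ℤ K (PowerSeries.X ^ p) = 1 := by
      rw [HahnSeries.ofPowerSeries_X_pow, HahnSeries.single_mul_single]
      simp
    rw [mul_left_comm (PowerSeries.C (y ^ n)), map_mul, ← mul_assoc, h1, one_mul, Finset.mul_sum,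
      map_sum]
    refine Finset.sum_congr rfl fun k hk => ?_
    rw [single_add_C_inv_pow hp, ← mul_assoc, ← map_mul PowerSeries.C, mul_div_cancel₀ _ hyn,
      map_mul, HahnSeries.ofPowerSeries_C]
    · rw [neg_sub_neg]
    · intro h
      exact Finset.ne_of_mem_erase hk (ha (by linear_combination h))

/-- The partial fraction expansion of `s⁻ᑫ ∏ⱼ ∑ₖ yⱼᵏ / (s + aₖ)^{pⱼ}`. -/
theorem partial_fraction_expansion {y : ι → K} (hy : ∀ j, y j ≠ 0) {p : ι → ℕ}
    (hp : ∀ j, 1 ≤ p j) {q : ℕ} (hq : 1 ≤ q) {a : ℕ → K} (ha : Function.Injective a)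
    (ha0 : ∀ n, a n ≠ 0) (M : ℕ) {m : K} (hm : m ≠ 0) (hma : ∀ n, m + a n ≠ 0) :
    (m⁻¹) ^ q * ∏ j, ∑ k ∈ Finset.range (M + 1), y j ^ k * ((m + a k)⁻¹) ^ p j
    = ∑ i ∈ Finset.range q, PowerSeries.coeff (q - 1 - i) (∏ j, ∑ k ∈ Finset.range (M + 1),
        PowerSeries.C (y j ^ k) * invPowSeries (p j) (a k)) * (m⁻¹) ^ (i + 1)
      + ∑ n ∈ Finset.range (M + 1), ∑ i ∈ Finset.range (∑ j, p j),
        PowerSeries.coeff ((∑ j, p j) - 1 - i) (PowerSeries.C ((∏ j, y j) ^ n) *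
          (invPowSeries q (-(a n)) * ∏ j, (1 + PowerSeries.X ^ p j *
            ∑ k ∈ (Finset.range (M + 1)).erase n,
              PowerSeries.C (y j ^ k / y j ^ n) * invPowSeries (p j) (a k - a n))))
          * ((m + a n)⁻¹) ^ (i + 1) := by
  classical
  set f : ι → K × (K → LaurentSeries K) := fun j =>
    ∑ k ∈ Finset.range (M + 1), constElt (y j ^ k) * poleElt m (-(a k)) ^ p j with hf
  set s : Finset K := insert 0 ((Finset.range (M + 1)).image fun n => -(a n)) with hs
  have hms : m ∉ s := by
    simp only [hs, Finset.mem_insert, Finset.mem_image, not_or, not_exists, not_and]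
    refine ⟨hm, fun n _ h => hma n ?_⟩
    rw [← h]
    ring
  have hfs : ∀ j, f j ∈ polesSpan m s := by
    intro j
    refine sum_mem fun k hk => constElt_mul_mem _ (poleElt_pow_mem ?_ (hp j))
    exact Finset.mem_insert_of_mem (Finset.mem_image_of_mem _ hk)
  have hv : poleElt m 0 ^ q * ∏ j, f j ∈ polesSpan m s := by
    have : ∀ t : Finset ι, poleElt m 0 ^ q * ∏ j ∈ t, f j ∈ polesSpan m s := by
      intro t
      induction t using Finset.induction_on with
      | empty =>
        rw [Finset.prod_empty, mul_one]
        exact poleElt_pow_mem (Finset.mem_insert_self _ _) hq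
      | insert i t hi ih =>
        rw [Finset.prod_insert hi, mul_left_comm]
        exact polesSpan_mul_mem hms (hfs i) ih
    exact this _
  obtain ⟨B₀, hB⟩ := eq_sum_principal_parts hv
  have key := hB (max B₀ (max q (∑ j, p j))) (le_max_left _ _)
  set B := max B₀ (max q (∑ j, p j)) with hBdef
  have hBq : q ≤ B := (le_max_left _ _).trans (le_max_right _ _)
  have hBp : ∑ j, p j ≤ B := (le_max_right _ _).trans (le_max_right _ _)
  have h0 : (0 : K) ∉ (Finset.range (M + 1)).image fun n => -(a n) := by
    simp only [Finset.mem_image, not_exists, not_and]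
    intro n _ h
    exact ha0 n (neg_eq_zero.1 h)
  have hinj : Set.InjOn (fun n => -(a n)) (Finset.range (M + 1) : Set ℕ) :=
    fun n _ n' _ h => ha (neg_injective h)
  rw [hs, Finset.sum_insert h0, Finset.sum_image hinj] at key
  have lhs : (poleElt m 0 ^ q * ∏ j, f j).1
      = (m⁻¹) ^ q * ∏ j, ∑ k ∈ Finset.range (M + 1), y j ^ k * ((m + a k)⁻¹) ^ p j := by
    simp only [Prod.fst_mul, Prod.pow_fst, Prod.fst_prod, hf, Prod.fst_sum, poleElt, constElt,
      sub_zero, sub_neg_eq_add]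
  have at0 : (poleElt m 0 ^ q * ∏ j, f j).2 0 = HahnSeries.single (-(q : ℤ)) 1 *
      HahnSeries.ofPowerSeries ℤ K (∏ j, ∑ k ∈ Finset.range (M + 1),
        PowerSeries.C (y j ^ k) * invPowSeries (p j) (a k)) := by
    simp only [Prod.snd_mul, Prod.pow_snd, Prod.snd_prod, hf, Prod.snd_sum, poleElt, constElt,
      Pi.mul_apply, Pi.pow_apply, Finset.prod_apply, Finset.sum_apply, map_prod, map_sum, map_mul]
    congr 1
    · rw [sub_zero, map_zero, add_zero, HahnSeries.inv_single, HahnSeries.single_pow]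
      simp
    · refine Finset.prod_congr rfl fun j _ => Finset.sum_congr rfl fun k _ => ?_
      rw [zero_sub, neg_neg, single_add_C_inv_pow (hp j) (ha0 k), HahnSeries.ofPowerSeries_C]
  have atn : ∀ n ∈ Finset.range (M + 1), (poleElt m 0 ^ q * ∏ j, f j).2 (-(a n)) =
      HahnSeries.single (-((∑ j, p j : ℕ) : ℤ)) 1 *
      HahnSeries.ofPowerSeries ℤ K (PowerSeries.C ((∏ j, y j) ^ n) *
          (invPowSeries q (-(a n)) * ∏ j, (1 + PowerSeries.X ^ p j *
            ∑ k ∈ (Finset.range (M + 1)).erase n,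
              PowerSeries.C (y j ^ k / y j ^ n) * invPowSeries (p j) (a k - a n)))) := by
    intro n hn
    have e1 : (∏ j, f j).2 (-(a n)) = ∏ j, ∑ k ∈ Finset.range (M + 1), HahnSeries.C (y j ^ k) *
      ((HahnSeries.single 1 1 + HahnSeries.C (-(a n) - -(a k)) : LaurentSeries K)⁻¹) ^ p j := by
      simp only [Prod.snd_mul, Prod.pow_snd, Prod.snd_prod, hf, Prod.snd_sum, poleElt, constElt,
        Pi.mul_apply, Pi.pow_apply, Finset.prod_apply, Finset.sum_apply]
    have e2 : (poleElt m 0 ^ q).2 (-(a n))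
        = HahnSeries.ofPowerSeries ℤ K (invPowSeries q (-(a n))) := by
      simp only [poleElt, Prod.pow_snd, Pi.pow_apply, sub_zero]
      exact single_add_C_inv_pow hq (neg_ne_zero.2 (ha0 n))
    rw [Prod.snd_mul, Pi.mul_apply, e1, e2,
      Finset.prod_congr rfl fun j _ => laurent_sum_at_pole (hp j) hn (hy j) ha,
      Finset.prod_mul_distrib, prod_single_neg, ← map_prod, mul_left_comm, ← map_mul,
      Finset.prod_mul_distrib, ← map_prod, Finset.prod_pow]
    congr 2
    rw [mul_left_comm]
  rw [lhs, at0, sum_single_mul_coeff _ _ hBq, sub_zero] at key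
  rw [key]
  congr 1
  refine Finset.sum_congr rfl fun n hn => ?_
  rw [atn n hn, sum_single_mul_coeff _ _ hBp, sub_neg_eq_add]

end PartialFractionFormula

/-! ### Roots of unity and the weights of the series. -/

lemma IsOfFinOrder.inv_complex {z : ℂ} (hz : IsOfFinOrder z) : IsOfFinOrder z⁻¹ := by
  obtain ⟨n, hn, h⟩ := isOfFinOrder_iff_pow_eq_one.1 hz
  exact isOfFinOrder_iff_pow_eq_one.2 ⟨n, hn, by rw [inv_pow, h, inv_one]⟩

lemma IsOfFinOrder.ne_zero_complex {z : ℂ} (hz : IsOfFinOrder z) : z ≠ 0 := by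
  rw [← norm_ne_zero_iff, hz.norm_eq_one]
  exact one_ne_zero

lemma IsOfFinOrder.prod_complex {ι : Type*} {y : ι → ℂ} (s : Finset ι)
    (hy : ∀ j ∈ s, IsOfFinOrder (y j)) : IsOfFinOrder (∏ j ∈ s, y j) := by
  classical
  induction s using Finset.induction_on with
  | empty => simp
  | insert i s hi ih =>
    rw [Finset.prod_insert hi]
    exact (Commute.all _ _).isOfFinOrder_mul (hy i (by simp)) (ih fun j hj => hy j (by simp [hj]))

lemma exponent_arg_inv {b : ℕ} {y : ℂ} (h : (b, y) ≠ (1, 1)) : (b, y⁻¹) ≠ (1, 1) := by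
  intro h'
  apply h
  simpa using h'

lemma sum_range_half_weight (z : ℂ) (hz : z ≠ 0) (a N : ℕ) :
    ∑ n ∈ Finset.range N, z ^ n / ((n : ℂ) + 1 / 2) ^ a = z⁻¹ * cycOddHarmonic a z N := by
  induction N with
  | zero => simp [cycOddHarmonic]
  | succ N ih =>
    rw [Finset.sum_range_succ, ih, cycOddHarmonic, cycOddHarmonic,
      Finset.sum_Icc_succ_top (by omega), mul_add]
    congr 1
    have : (((N + 1 : ℕ) : ℂ) - 1 / 2) = (N : ℂ) + 1 / 2 := by push_cast; ring
    rw [this, pow_succ]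
    field_simp

/-- The term n = 0 is zero by the convention for division by zero, so series over `Finset.range` and
over n ≥ 1 agree. -/
lemma sum_range_succ_weight (z : ℂ) {a : ℕ} (ha : 1 ≤ a) (N : ℕ) (f : ℕ → ℂ) :
    ∑ n ∈ Finset.range (N + 1), z ^ n / (n : ℂ) ^ a * f n
      = ∑ n ∈ Finset.Icc 1 N, z ^ n / (n : ℂ) ^ a * f n := by
  rw [Finset.range_eq_Ico, Finset.sum_eq_sum_Ico_succ_bot (by omega)]
  simp [show a ≠ 0 by omega]
  rfl

lemma half_weight_bound {z : ℂ} (hz : ‖z‖ = 1) {a : ℕ} (ha : 1 ≤ a) (n : ℕ) :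
    ‖z ^ n / ((n : ℂ) + 1 / 2) ^ a‖ ≤ (2 : ℝ) ^ a / (n + 1) := by
  have h1 : ‖(n : ℂ) + 1 / 2‖ = (n : ℝ) + 1 / 2 := by
    have : (n : ℂ) + 1 / 2 = (((n : ℝ) + 1 / 2 : ℝ) : ℂ) := by push_cast; ring
    rw [this, Complex.norm_real, Real.norm_of_nonneg (by positivity)]
  rw [norm_div, norm_pow, norm_pow, hz, one_pow, h1]
  have h2 : (((n : ℝ) + 1) / 2) ^ a ≤ ((n : ℝ) + 1 / 2) ^ a :=
    pow_le_pow_left₀ (by positivity) (by have : (0 : ℝ) ≤ n := by positivity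
                                         linarith) a
  have h3 : (n : ℝ) + 1 ≤ ((n : ℝ) + 1) ^ a :=
    le_self_pow₀ (by have : (0 : ℝ) ≤ n := by positivity
                     linarith) (by omega)
  calc 1 / ((n : ℝ) + 1 / 2) ^ a ≤ 1 / (((n : ℝ) + 1) / 2) ^ a :=
        one_div_le_one_div_of_le (by positivity) h2
    _ = 2 ^ a / ((n : ℝ) + 1) ^ a := by rw [div_pow, one_div_div]
    _ ≤ 2 ^ a / ((n : ℝ) + 1) := by gcongr

lemma weight_bound {z : ℂ} (hz : ‖z‖ = 1) {a : ℕ} (ha : 1 ≤ a) (n : ℕ) :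
    ‖z ^ n / (n : ℂ) ^ a‖ ≤ (2 : ℝ) / (n + 1) := by
  rcases Nat.eq_zero_or_pos n with rfl | hn
  · simp [show a ≠ 0 by omega]
  · rw [norm_div, norm_pow, norm_pow, hz, one_pow, Complex.norm_natCast]
    have h1 : (1 : ℝ) ≤ n := by exact_mod_cast hn
    have h2 : (n : ℝ) ≤ (n : ℝ) ^ a := le_self_pow₀ h1 (by omega)
    rw [div_le_div_iff₀ (by positivity) (by positivity)]
    linarith

lemma half_weight_tendsto {z : ℂ} (hz : IsOfFinOrder z) {a : ℕ} (ha : 1 ≤ a)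
    (haz : (a, z) ≠ (1, 1)) :
    ∃ W, Tendsto (fun N => ∑ n ∈ Finset.range N, z ^ n / ((n : ℂ) + 1 / 2) ^ a) atTop (𝓝 W) := by
  obtain ⟨T, K, h⟩ := cycOddHarmonic_tail ha hz.norm_eq_one haz
  refine ⟨z⁻¹ * T, ?_⟩
  simp only [sum_range_half_weight z hz.ne_zero_complex]
  exact (tendsto_of_tail_bound h).const_mul _

lemma weight_tendsto {z : ℂ} (hz : IsOfFinOrder z) {a : ℕ} (ha : 1 ≤ a)
    (haz : (a, z) ≠ (1, 1)) :
    ∃ W, Tendsto (fun N => ∑ n ∈ Finset.range N, z ^ n / (n : ℂ) ^ a) atTop (𝓝 W) := by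
  obtain ⟨T, K, h⟩ := cycHarmonic_tail ha hz.norm_eq_one haz
  refine ⟨T, (tendsto_add_atTop_iff_nat 1).1 ?_⟩
  refine (tendsto_of_tail_bound h).congr fun N => ?_
  have := sum_range_succ_weight z ha N (fun _ => 1)
  simpa [cycHarmonic] using this.symm

lemma tendsto_sum_prod_expand {ι : Type*} [DecidableEq ι] (J : Finset ι) {w : ℕ → ℂ}
    {h : ι → ℕ → ℂ} (c s : ι → ℂ) {L : Finset ι → ℂ}
    (hL : ∀ I ⊆ J, Tendsto (fun N => ∑ n ∈ Finset.range N, w n * ∏ j ∈ I, h j n) atTop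
      (𝓝 (L I))) :
    Tendsto (fun N => ∑ n ∈ Finset.range N, w n * ∏ j ∈ J, (s j * h j n + c j)) atTop
      (𝓝 (∑ I ∈ J.powerset, (∏ j ∈ I, s j) * (∏ j ∈ J \ I, c j) * L I)) := by
  refine (tendsto_finsetSum _ fun I hI =>
    (hL I (Finset.mem_powerset.1 hI)).const_mul _).congr fun N => ?_
  simp only [Finset.mul_sum]
  rw [Finset.sum_comm]
  refine Finset.sum_congr rfl fun n _ => ?_
  rw [Finset.prod_add, Finset.mul_sum]
  refine Finset.sum_congr rfl fun I _ => ?_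
  rw [Finset.prod_mul_distrib]
  ring

/-! ### Limits lying in an algebra that contains the lower order sums. -/

section Membership

variable {r : ℕ} {A : Subalgebra ℚ ℂ}

lemma prod_finset_eq_prod_fin {ι : Type*} (I : Finset ι) (f : ι → ℂ) :
    ∏ i : Fin I.card, f (I.equivFin.symm i) = ∏ j ∈ I, f j := by
  rw [← Finset.prod_coe_sort I f]
  exact I.equivFin.symm.prod_comp (fun j : I => f j)

lemma rSum_mem (hA : lowerOrderSums r ⊆ A) {ι : Type*} {I : Finset ι} (hI : I.card < r)
    {b : ι → ℕ} {v : ι → ℂ} (hb : ∀ j, 1 ≤ b j) (hv : ∀ j, IsOfFinOrder (v j)) {z : ℂ}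
    (hz : IsOfFinOrder z) {a : ℕ} (ha : 1 ≤ a) (haz : (a, z) ≠ (1, 1)) {L : ℂ}
    (hL : Tendsto (fun N => ∑ n ∈ Finset.range N, z ^ n / ((n : ℂ) + 1 / 2) ^ a *
      ∏ j ∈ I, cycHarmonic (b j) (v j) n) atTop (𝓝 L)) : L ∈ A := by
  refine hA ⟨I.card, hI, fun i => b (I.equivFin.symm i), a, fun i => v (I.equivFin.symm i), z,
    fun _ => hb _, ha, fun _ => hv _, hz, haz, Or.inr ?_⟩
  refine hL.congr fun N => Finset.sum_congr rfl fun n _ => ?_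
  rw [prod_finset_eq_prod_fin I (fun j => cycHarmonic (b j) (v j) n)]
  ring

lemma tildeSSum_mem (hA : lowerOrderSums r ⊆ A) {ι : Type*} {I : Finset ι} (hI : I.card < r)
    {b : ι → ℕ} {v : ι → ℂ} (hb : ∀ j, 1 ≤ b j) (hv : ∀ j, IsOfFinOrder (v j)) {z : ℂ}
    (hz : IsOfFinOrder z) {a : ℕ} (ha : 1 ≤ a) (haz : (a, z) ≠ (1, 1)) {L : ℂ}
    (hL : Tendsto (fun N => ∑ n ∈ Finset.range N, z ^ n / (n : ℂ) ^ a *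
      ∏ j ∈ I, cycOddHarmonic (b j) (v j) n) atTop (𝓝 L)) : L ∈ A := by
  refine hA ⟨I.card, hI, fun i => b (I.equivFin.symm i), a, fun i => v (I.equivFin.symm i), z,
    fun _ => hb _, ha, fun _ => hv _, hz, haz, Or.inl ?_⟩
  refine (hL.comp (tendsto_add_atTop_nat 1)).congr fun N => ?_
  rw [Function.comp, sum_range_succ_weight z ha]
  refine Finset.sum_congr rfl fun n _ => ?_
  rw [prod_finset_eq_prod_fin I (fun j => cycOddHarmonic (b j) (v j) n)]
  ring

/-- The limit is an S̃-sum of order 0, which counts as lower order because r ≥ 1. -/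
lemma cycHarmonic_limit_mem (hr : 1 ≤ r) (hA : lowerOrderSums r ⊆ A) {b : ℕ} {y T : ℂ}
    (hb : 1 ≤ b) (hy : IsOfFinOrder y) (hby : (b, y) ≠ (1, 1))
    (hT : Tendsto (cycHarmonic b y) atTop (𝓝 T)) : T ∈ A := by
  refine hA ⟨0, hr, fun _ => 1, b, fun _ => 1, y, fun _ => le_rfl, hb, fun j => j.elim0, hy, hby,
    Or.inl ?_⟩
  refine hT.congr fun N => Finset.sum_congr rfl fun n _ => ?_
  simp [div_eq_inv_mul]

/-- Up to the factor y, produced by the index shift, the limit is an R-sum of order 0. -/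
lemma cycOddHarmonic_limit_mem (hr : 1 ≤ r) (hA : lowerOrderSums r ⊆ A) {b : ℕ} {y T : ℂ}
    (hb : 1 ≤ b) (hy : IsOfFinOrder y) (hby : (b, y) ≠ (1, 1)) (hyA : y ∈ A)
    (hT : Tendsto (cycOddHarmonic b y) atTop (𝓝 T)) : T ∈ A := by
  have h : y⁻¹ * T ∈ A := by
    refine hA ⟨0, hr, fun _ => 1, b, fun _ => 1, y, fun _ => le_rfl, hb, fun j => j.elim0, hy,
      hby, Or.inr ?_⟩
    refine (hT.const_mul y⁻¹).congr fun N => ?_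
    rw [← sum_range_half_weight y hy.ne_zero_complex]
    refine Finset.sum_congr rfl fun n _ => ?_
    simp [div_eq_inv_mul]
  have := mul_mem hyA h
  rwa [mul_inv_cancel_left₀ hy.ne_zero_complex] at this

/-- `∑ yᵏ / kᵇ` over `-n ≤ k ≤ M - n`, `k ≠ 0` (for `n ≤ M`). -/
noncomputable def puncturedHarmonic (b : ℕ) (y : ℂ) (M n : ℕ) : ℂ :=
  cycHarmonic b y (M - n) + (-1) ^ b * cycHarmonic b y⁻¹ n

/-- The indices k > n give the first harmonic number; the indices k < n, reflected, give the second
with sign (-1)^b and inverted argument. -/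
lemma sum_erase_eq_puncturedHarmonic {y : ℂ} (hy : y ≠ 0) (b : ℕ) {M n : ℕ} (hn : n ≤ M) :
    ∑ k ∈ (Finset.range (M + 1)).erase n, y ^ k / y ^ n * (((k : ℂ) - n) ^ b)⁻¹
      = puncturedHarmonic b y M n := by
  obtain ⟨d, rfl⟩ := Nat.exists_eq_add_of_le hn
  have h1 : ∑ k ∈ (Finset.range (n + d + 1)).erase n, y ^ k / y ^ n * (((k : ℂ) - n) ^ b)⁻¹
      = ∑ k ∈ Finset.range n, y ^ k / y ^ n * (((k : ℂ) - n) ^ b)⁻¹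
        + ∑ k ∈ Finset.range d, y ^ (n + 1 + k) / y ^ n * ((((n + 1 + k : ℕ) : ℂ) - n) ^ b)⁻¹ := by
    have h2 := Finset.add_sum_erase (Finset.range (n + d + 1))
      (fun k : ℕ => y ^ k / y ^ n * (((k : ℂ) - n) ^ b)⁻¹) (a := n) (by simp)
    have h3 := Finset.sum_range_add (fun k : ℕ => y ^ k / y ^ n * (((k : ℂ) - n) ^ b)⁻¹) (n + 1) d
    rw [Finset.sum_range_succ, show n + 1 + d = n + d + 1 by omega] at h3
    linear_combination h2 + h3
  rw [h1, puncturedHarmonic, Nat.add_sub_cancel_left, add_comm]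
  have hI : ∀ (N : ℕ) (f : ℕ → ℂ), ∑ k ∈ Finset.Icc 1 N, f k = ∑ k ∈ Finset.range N, f (k + 1) := by
    intro N f
    induction N with
    | zero => simp
    | succ N ih => rw [Finset.sum_Icc_succ_top (by omega), ih, Finset.sum_range_succ]
  congr 1
  · rw [cycHarmonic, hI]
    refine Finset.sum_congr rfl fun k _ => ?_
    have : ((n + 1 + k : ℕ) : ℂ) - n = ((k + 1 : ℕ) : ℂ) := by push_cast; ring
    rw [this, add_assoc, pow_add, mul_div_cancel_left₀ _ (pow_ne_zero _ hy), add_comm 1 k,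
      div_eq_mul_inv]
  · rw [cycHarmonic, hI, ← Finset.sum_range_reflect, Finset.mul_sum]
    refine Finset.sum_congr rfl fun k hk => ?_
    have hk' : k + 1 ≤ n := Finset.mem_range.1 hk
    obtain ⟨e, rfl⟩ := Nat.exists_eq_add_of_le hk'
    have e1 : k + 1 + e - 1 - k = e := by omega
    rw [e1]
    have : ((e : ℕ) : ℂ) - ((k + 1 + e : ℕ) : ℂ) = (-1) * ((k + 1 : ℕ) : ℂ) := by push_cast; ring
    rw [this, mul_pow, mul_inv, pow_add y (k + 1) e, inv_pow]
    have h5 : ((-1 : ℂ) ^ b)⁻¹ = (-1) ^ b := by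
      rw [← inv_pow]
      norm_num
    rw [h5]
    field_simp

/-- Truncated sums against products of punctured harmonic sums converge to lower order sums. -/
lemma exists_limit_sum_prod_puncturedHarmonic (hA : lowerOrderSums r ⊆ A) {ι : Type*}
    {J : Finset ι} (hJ : J.card < r) {b : ι → ℕ} {y : ι → ℂ} (hb : ∀ j, 1 ≤ b j)
    (hy : ∀ j, IsOfFinOrder (y j)) (hby : ∀ j, (b j, y j) ≠ (1, 1)) {z : ℂ}
    (hz : IsOfFinOrder z) {a : ℕ} (ha : 1 ≤ a) (haz : (a, z) ≠ (1, 1)) :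
    ∃ L ∈ A, Tendsto (fun M => ∑ n ∈ Finset.range (M + 1), z ^ n / ((n : ℂ) + 1 / 2) ^ a *
      ∏ j ∈ J, puncturedHarmonic (b j) (y j) M n) atTop (𝓝 L) := by
  classical
  choose T K hT using fun j => cycHarmonic_tail (hb j) (hy j).norm_eq_one (hby j)
  choose T' K' hT' using fun j => cycHarmonic_tail (hb j) (hy j).inv_complex.norm_eq_one
    (exponent_arg_inv (hby j))
  obtain ⟨W, hW⟩ := half_weight_tendsto hz ha haz
  have hbd := half_weight_bound hz.norm_eq_one ha
  -- The indicator of n ≤ M turns the truncated sum into a full series. As M grows, each punctured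
  -- sum tends to T_j plus a multiple of ζ_n(b_j; y_j⁻¹).
  have tame : IsTame (fun M n => (if n ≤ M then 1 else 0) *
      ∏ j ∈ J, puncturedHarmonic (b j) (y j) M n)
      (fun n => 1 * ∏ j ∈ J, (T j + (-1) ^ b j * cycHarmonic (b j) (y j)⁻¹ n)) :=
    IsTame.indicator.mul (IsTame.prod J fun j _ => (IsTame.of_tail_sub (hT j)).add
      ((IsTame.const ((-1) ^ b j)).mul (IsTame.of_tail (hT' j))))
  obtain ⟨S, S', hS, hSS', hS'⟩ := tame.tendsto_sum hW hbd
  have hlow : ∀ I ⊆ J, ∃ L ∈ A, Tendsto (fun N => ∑ n ∈ Finset.range N,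
      z ^ n / ((n : ℂ) + 1 / 2) ^ a * ∏ j ∈ I, cycHarmonic (b j) (y j)⁻¹ n) atTop (𝓝 L) := by
    intro I hI
    obtain ⟨-, L, -, -, hL⟩ := (IsTame.prod I fun j _ => IsTame.of_tail (hT' j)).tendsto_sum hW hbd
    exact ⟨L, rSum_mem hA ((Finset.card_le_card hI).trans_lt hJ) hb
      (fun j => (hy j).inv_complex) hz ha haz hL, hL⟩
  choose! L hLA hL using hlow
  have hexp := tendsto_sum_prod_expand J T (fun j => (-1) ^ b j) hL
  have hS'mem : S' ∈ A := by
    have heq : S' = _ := tendsto_nhds_unique (hS'.congr fun N => by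
      refine Finset.sum_congr rfl fun n _ => ?_
      rw [one_mul]
      congr 1
      exact Finset.prod_congr rfl fun j _ => add_comm _ _) hexp
    rw [heq]
    refine sum_mem fun I hI => mul_mem (mul_mem ?_ ?_) (hLA I (Finset.mem_powerset.1 hI))
    · exact prod_mem fun j _ => pow_mem (neg_mem (one_mem A)) _
    · exact prod_mem fun j _ => cycHarmonic_limit_mem (by omega) hA (hb j) (hy j) (hby j)
        (tendsto_of_tail_bound (hT j))
  refine ⟨S', hS'mem, hSS'.congr fun M => ?_⟩
  refine tendsto_nhds_unique (hS M) (tendsto_const_nhds.congr' ?_)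
  filter_upwards [eventually_ge_atTop (M + 1)] with N hN
  obtain ⟨d, rfl⟩ := Nat.exists_eq_add_of_le hN
  rw [Finset.sum_range_add _ (M + 1) d]
  have h0 : ∑ x ∈ Finset.range d, z ^ (M + 1 + x) / (((M + 1 + x : ℕ) : ℂ) + 1 / 2) ^ a *
      ((if M + 1 + x ≤ M then 1 else 0) *
        ∏ j ∈ J, puncturedHarmonic (b j) (y j) M (M + 1 + x)) = 0 := by
    refine Finset.sum_eq_zero fun n _ => ?_
    rw [if_neg (by omega), zero_mul, mul_zero]
  rw [h0, add_zero]
  refine Finset.sum_congr rfl fun n hn => ?_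
  rw [if_pos (Nat.lt_succ_iff.1 (Finset.mem_range.1 hn)), one_mul]

end Membership

/-! ### Limits of the principal part coefficients. -/

section PoleCoefficients

variable {r : ℕ} {A : Subalgebra ℚ ℂ}

/-- All admissible weighted truncated sums of the family `g` converge to elements of `A`. -/
def HasWeightedLimits (A : Subalgebra ℚ ℂ) (g : ℕ → ℕ → ℂ) : Prop :=
  ∀ (z : ℂ) (a : ℕ), IsOfFinOrder z → 1 ≤ a → (a, z) ≠ (1, 1) → ∃ L ∈ A,
    Tendsto (fun M => ∑ n ∈ Finset.range (M + 1), z ^ n / ((n : ℂ) + 1 / 2) ^ a * g M n)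
      atTop (𝓝 L)

lemma HasWeightedLimits.congr {g g' : ℕ → ℕ → ℂ} (h : HasWeightedLimits A g)
    (hg : ∀ M n, n ≤ M → g' M n = g M n) : HasWeightedLimits A g' := by
  intro z a hz ha haz
  obtain ⟨L, hLA, hL⟩ := h z a hz ha haz
  refine ⟨L, hLA, hL.congr fun M => Finset.sum_congr rfl fun n hn => ?_⟩
  rw [hg M n (Nat.lt_succ_iff.1 (Finset.mem_range.1 hn))]

lemma HasWeightedLimits.const_mul {g : ℕ → ℕ → ℂ} (h : HasWeightedLimits A g) {c : ℂ}
    (hc : c ∈ A) : HasWeightedLimits A (fun M n => c * g M n) := by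
  intro z a hz ha haz
  obtain ⟨L, hLA, hL⟩ := h z a hz ha haz
  refine ⟨c * L, mul_mem hc hLA, (hL.const_mul c).congr fun M => ?_⟩
  rw [Finset.mul_sum]
  exact Finset.sum_congr rfl fun n _ => by ring

lemma HasWeightedLimits.sum {κ : Type*} (s : Finset κ) {g : κ → ℕ → ℕ → ℂ}
    (h : ∀ i ∈ s, HasWeightedLimits A (g i)) :
    HasWeightedLimits A (fun M n => ∑ i ∈ s, g i M n) := by
  intro z a hz ha haz
  choose! L hLA hL using fun i hi => h i hi z a hz ha haz
  refine ⟨∑ i ∈ s, L i, sum_mem hLA, (tendsto_finsetSum s hL).congr fun M => ?_⟩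
  rw [Finset.sum_comm]
  exact Finset.sum_congr rfl fun n _ => by rw [Finset.mul_sum]

/-- Below degree p the coefficient is zero and the harmonic factor is arbitrary; `max p l` keeps its
exponent at least p, so the excluded pair (1, 1) never appears. -/
lemma coeff_X_pow_mul_sum_erase {y : ℂ} (hy : y ≠ 0) (p l : ℕ) {M n : ℕ} (hn : n ≤ M) :
    PowerSeries.coeff l (PowerSeries.X ^ p * ∑ k ∈ (Finset.range (M + 1)).erase n,
      PowerSeries.C (y ^ k / y ^ n) *
        invPowSeries p (((k : ℂ) + 1 / 2) - ((n : ℂ) + 1 / 2)))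
    = (if p ≤ l then (-1) ^ (l - p) * (((p - 1 + (l - p)).choose (p - 1) : ℕ) : ℂ) else 0)
      * puncturedHarmonic (max p l) y M n := by
  rw [PowerSeries.coeff_X_pow_mul']
  split_ifs with h
  · rw [max_eq_right h, ← sum_erase_eq_puncturedHarmonic hy l hn, map_sum, Finset.mul_sum]
    refine Finset.sum_congr rfl fun k _ => ?_
    rw [PowerSeries.coeff_C_mul, invPowSeries, PowerSeries.coeff_mk, add_sub_add_right_eq_sub,
      Nat.add_sub_cancel' h]
    ring
  · rw [zero_mul]

lemma natCast_mem_subalgebra (n : ℕ) : (n : ℂ) ∈ A := natCast_mem A n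

lemma neg_one_pow_mem_subalgebra (n : ℕ) : (-1 : ℂ) ^ n ∈ A := pow_mem (neg_mem (one_mem A)) n

/-- This is where the order drops. In the expansion of ∏ (1 + X^(p_j) G_j) over subsets J, the full
subset is divisible by X^(∑ p_j) and contributes nothing in degree t < ∑ p_j. Every other J has
fewer than r harmonic factors. -/
lemma hasWeightedLimits_coeff_at_pole (hA : lowerOrderSums r ⊆ A) {p : Fin r → ℕ}
    {y : Fin r → ℂ} (hp : ∀ j, 1 ≤ p j) (hy : ∀ j, IsOfFinOrder (y j))
    (hpy : ∀ j, (p j, y j) ≠ (1, 1)) {t : ℕ} (ht : t < ∑ j, p j) :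
    HasWeightedLimits A (fun M n => PowerSeries.coeff t (∏ j, (1 + PowerSeries.X ^ p j *
      ∑ k ∈ (Finset.range (M + 1)).erase n, PowerSeries.C (y j ^ k / y j ^ n) *
        invPowSeries (p j) (((k : ℂ) + 1 / 2) - ((n : ℂ) + 1 / 2))))) := by
  classical
  simp only [Finset.prod_one_add, map_sum]
  refine HasWeightedLimits.sum _ fun J _ => ?_
  by_cases hJ : J = Finset.univ
  · have h0 : HasWeightedLimits A (fun _ _ => 0) := by
      intro z a _ _ _
      exact ⟨0, zero_mem A, by simp⟩
    refine h0.congr fun M n _ => ?_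
    rw [hJ, Finset.prod_mul_distrib, Finset.prod_pow_eq_pow_sum, PowerSeries.coeff_X_pow_mul',
      if_neg (by omega)]
  · have hcard : J.card < r := by
      have := Finset.card_lt_univ_of_notMem (s := J)
        (not_forall.1 fun h => hJ (Finset.eq_univ_iff_forall.2 h)).choose_spec
      simpa using this
    have h1 : HasWeightedLimits A (fun M n => ∑ l ∈ Finset.finsuppAntidiag J t,
        (∏ j ∈ J, if p j ≤ l j then (-1) ^ (l j - p j) *
          (((p j - 1 + (l j - p j)).choose (p j - 1) : ℕ) : ℂ) else 0) *
        ∏ j ∈ J, puncturedHarmonic (max (p j) (l j)) (y j) M n) := by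
      refine HasWeightedLimits.sum _ fun l _ => HasWeightedLimits.const_mul ?_ ?_
      · intro z a hz ha haz
        refine exists_limit_sum_prod_puncturedHarmonic hA hcard
          (fun j => (hp j).trans (le_max_left _ _)) hy (fun j h => ?_) hz ha haz
        rw [Prod.mk.injEq] at h
        have h2 := le_max_left (p j) (l j)
        have h3 := hp j
        exact hpy j (Prod.ext (by simp only; omega) h.2)
      · refine prod_mem fun j _ => ?_
        split_ifs
        · exact mul_mem (neg_one_pow_mem_subalgebra _) (natCast_mem_subalgebra _)
        · exact zero_mem A
    refine h1.congr fun M n hn => ?_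
    rw [PowerSeries.coeff_prod]
    refine Finset.sum_congr rfl fun l _ => ?_
    rw [← Finset.prod_mul_distrib]
    exact Finset.prod_congr rfl fun j _ =>
      coeff_X_pow_mul_sum_erase (hy j).ne_zero_complex (p j) (l j) hn

/-- Each Taylor coefficient of a factor at 0 is a rational multiple of y_j⁻¹ times a partial sum of
t_n, and a coefficient of the product is a finite sum of products of these. -/
lemma exists_limit_coeff_at_zero (hr : 1 ≤ r) (hA : lowerOrderSums r ⊆ A) {p : Fin r → ℕ}
    {y : Fin r → ℂ} (hp : ∀ j, 1 ≤ p j) (hy : ∀ j, IsOfFinOrder (y j)) (hyA : ∀ j, y j ∈ A)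
    (hyA' : ∀ j, (y j)⁻¹ ∈ A) (hpy : ∀ j, (p j, y j) ≠ (1, 1)) (t : ℕ) :
    ∃ L ∈ A, Tendsto (fun M => PowerSeries.coeff t (∏ j, ∑ k ∈ Finset.range (M + 1),
      PowerSeries.C (y j ^ k) * invPowSeries (p j) ((k : ℂ) + 1 / 2))) atTop (𝓝 L) := by
  classical
  have h1 : ∀ (j : Fin r) (l : ℕ), ∃ L ∈ A, Tendsto (fun M => PowerSeries.coeff l
      (∑ k ∈ Finset.range (M + 1), PowerSeries.C (y j ^ k) *
        invPowSeries (p j) ((k : ℂ) + 1 / 2))) atTop (𝓝 L) := by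
    intro j l
    have hb : 1 ≤ p j + l := (hp j).trans (Nat.le_add_right _ _)
    have hby : (p j + l, y j) ≠ (1, 1) := by
      intro h
      rw [Prod.mk.injEq] at h
      have := hp j
      exact hpy j (Prod.ext (by simp only; omega) h.2)
    obtain ⟨T, K, hT⟩ := cycOddHarmonic_tail hb (hy j).norm_eq_one hby
    have hT := tendsto_of_tail_bound hT
    refine ⟨(-1) ^ l * (((p j - 1 + l).choose (p j - 1) : ℕ) : ℂ) * ((y j)⁻¹ * T),
      mul_mem (mul_mem (neg_one_pow_mem_subalgebra _) (natCast_mem_subalgebra _))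
        (mul_mem (hyA' j) (cycOddHarmonic_limit_mem hr hA hb (hy j) hby (hyA j) hT)), ?_⟩
    refine (((hT.comp (tendsto_add_atTop_nat 1)).const_mul (y j)⁻¹).const_mul _).congr fun M => ?_
    rw [Function.comp, ← sum_range_half_weight _ (hy j).ne_zero_complex, map_sum, Finset.mul_sum]
    refine Finset.sum_congr rfl fun k _ => ?_
    rw [PowerSeries.coeff_C_mul, invPowSeries, PowerSeries.coeff_mk]
    ring
  choose L hLA hL using h1
  refine ⟨∑ l ∈ Finset.finsuppAntidiag Finset.univ t, ∏ j, L j (l j),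
    sum_mem fun l _ => prod_mem fun j _ => hLA j _, ?_⟩
  simp only [PowerSeries.coeff_prod]
  exact tendsto_finsetSum _ fun l _ => tendsto_finsetProd _ fun j _ => hL j (l j)

/-- The contribution of the poles `-(n + 1/2)`. -/
lemma exists_limit_sum_coeff (hA : lowerOrderSums r ⊆ A) {p : Fin r → ℕ}
    {y : Fin r → ℂ} (hp : ∀ j, 1 ≤ p j) (hy : ∀ j, IsOfFinOrder (y j))
    (hpy : ∀ j, (p j, y j) ≠ (1, 1)) {q : ℕ} (hq : 1 ≤ q) {t : ℕ} (ht : t < ∑ j, p j)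
    {z : ℂ} (hz : IsOfFinOrder z) (e : ℕ) (hz1 : (q + e, z) ≠ (1, 1)) :
    ∃ L ∈ A, Tendsto (fun M => ∑ n ∈ Finset.range (M + 1), z ^ n / ((n : ℂ) + 1 / 2) ^ e *
      PowerSeries.coeff t (invPowSeries q (-((n : ℂ) + 1 / 2)) *
        ∏ j, (1 + PowerSeries.X ^ p j * ∑ k ∈ (Finset.range (M + 1)).erase n,
          PowerSeries.C (y j ^ k / y j ^ n) *
            invPowSeries (p j) (((k : ℂ) + 1 / 2) - ((n : ℂ) + 1 / 2))))) atTop (𝓝 L) := by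
  -- The coefficient of degree `st.1` in the expansion of s^(-q) at -(n + 1/2) raises the exponent
  -- of the weight from e to q + e + `st.1`.
  have h1 : ∀ st ∈ Finset.HasAntidiagonal.antidiagonal t, ∃ L ∈ A, Tendsto (fun M => ∑ n ∈ Finset.range (M + 1),
      z ^ n / ((n : ℂ) + 1 / 2) ^ (q + e + st.1) *
      PowerSeries.coeff st.2 (∏ j, (1 + PowerSeries.X ^ p j *
        ∑ k ∈ (Finset.range (M + 1)).erase n, PowerSeries.C (y j ^ k / y j ^ n) *
            invPowSeries (p j) (((k : ℂ) + 1 / 2) - ((n : ℂ) + 1 / 2))))) atTop (𝓝 L) := by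
    intro st hst
    rw [Finset.HasAntidiagonal.mem_antidiagonal] at hst
    refine hasWeightedLimits_coeff_at_pole hA hp hy hpy (by omega) z _ hz (by omega) fun h => ?_
    rw [Prod.mk.injEq] at h
    exact hz1 (Prod.ext (by simp only; omega) h.2)
  choose! L hLA hL using h1
  refine ⟨∑ st ∈ Finset.HasAntidiagonal.antidiagonal t, ((-1) ^ st.1 *
      (((q - 1 + st.1).choose (q - 1) : ℕ) : ℂ) * (-1) ^ (q + st.1)) * L st,
    sum_mem fun st hst => mul_mem (mul_mem (mul_mem (neg_one_pow_mem_subalgebra _)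
      (natCast_mem_subalgebra _)) (neg_one_pow_mem_subalgebra _)) (hLA st hst), ?_⟩
  refine (tendsto_finsetSum _ fun st hst => (hL st hst).const_mul _).congr fun M => ?_
  simp only [Finset.mul_sum]
  rw [Finset.sum_comm]
  refine Finset.sum_congr rfl fun n _ => ?_
  rw [PowerSeries.coeff_mul, Finset.mul_sum]
  refine Finset.sum_congr rfl fun st _ => ?_
  have h2 : (((-((n : ℂ) + 1 / 2)) ^ (q + st.1))⁻¹ : ℂ)
      = (-1) ^ (q + st.1) * (((n : ℂ) + 1 / 2) ^ (q + st.1))⁻¹ := by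
    rw [neg_pow, mul_inv, ← inv_pow (-1 : ℂ)]
    norm_num
  rw [invPowSeries, PowerSeries.coeff_mk, h2, div_eq_mul_inv, div_eq_mul_inv,
    show q + e + st.1 = e + (q + st.1) by ring, pow_add _ e, mul_inv]
  ring

end PoleCoefficients

/-! ### Odd harmonic numbers at all integers. -/

/-- The extension of `n ↦ t_n(p; y)` to all integers satisfying the same recurrence. -/
noncomputable def cycOddHarmonicInt (p : ℕ) (y : ℂ) (n : ℤ) : ℂ :=
  if 0 ≤ n then cycOddHarmonic p y n.toNat
  else (-1) ^ (p + 1) * y * cycOddHarmonic p y⁻¹ (-n).toNat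

lemma cycOddHarmonicInt_natCast (p : ℕ) (y : ℂ) (n : ℕ) :
    cycOddHarmonicInt p y n = cycOddHarmonic p y n := by
  simp [cycOddHarmonicInt]

lemma cycOddHarmonicInt_neg_natCast (p : ℕ) (y : ℂ) (n : ℕ) :
    cycOddHarmonicInt p y (-n) = (-1) ^ (p + 1) * y * cycOddHarmonic p y⁻¹ n := by
  rcases Nat.eq_zero_or_pos n with rfl | hn
  · simp [cycOddHarmonicInt, cycOddHarmonic]
  · rw [cycOddHarmonicInt, if_neg (by omega)]
    simp

lemma cycOddHarmonic_succ (p : ℕ) (y : ℂ) (n : ℕ) :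
    cycOddHarmonic p y (n + 1) = cycOddHarmonic p y n + y ^ (n + 1) / ((n : ℂ) + 1 / 2) ^ p := by
  rw [cycOddHarmonic, cycOddHarmonic, Finset.sum_Icc_succ_top (by omega)]
  congr 3
  push_cast
  ring

lemma cycOddHarmonicInt_succ (p : ℕ) {y : ℂ} (hy : y ≠ 0) (n : ℤ) :
    cycOddHarmonicInt p y (n + 1)
      = cycOddHarmonicInt p y n + y ^ (n + 1) / ((n : ℂ) + 1 / 2) ^ p := by
  obtain ⟨m, rfl | rfl⟩ : ∃ m : ℕ, n = m ∨ n = -((m + 1 : ℕ) : ℤ) := by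
    rcases lt_or_ge n 0 with h | h
    · exact ⟨(-n).toNat - 1, Or.inr (by omega)⟩
    · exact ⟨n.toNat, Or.inl (by omega)⟩
  · have h1 : ((m : ℤ) + 1) = ((m + 1 : ℕ) : ℤ) := by push_cast; ring
    rw [h1, cycOddHarmonicInt_natCast, cycOddHarmonicInt_natCast, cycOddHarmonic_succ,
      zpow_natCast]
    simp
  · have h1 : (-((m + 1 : ℕ) : ℤ) + 1) = -(m : ℤ) := by push_cast; ring
    rw [h1, cycOddHarmonicInt_neg_natCast, cycOddHarmonicInt_neg_natCast, cycOddHarmonic_succ,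
      zpow_neg, zpow_natCast]
    have h2 : ((-((m + 1 : ℕ) : ℤ) : ℤ) : ℂ) + 1 / 2 = (-1) * ((m : ℂ) + 1 / 2) := by
      push_cast; ring
    have h3 : ((-1 : ℂ) ^ p)⁻¹ = (-1) ^ p := by
      rw [← inv_pow]
      norm_num
    rw [h2, mul_pow, div_eq_mul_inv _ ((-1 : ℂ) ^ p * _), mul_inv, h3, inv_pow, pow_succ y,
      pow_succ (-1 : ℂ), mul_inv, div_eq_mul_inv]
    field_simp
    ring

lemma sum_range_eq_cycOddHarmonicInt_sub (p : ℕ) {y : ℂ} (hy : y ≠ 0) (m : ℤ) (N : ℕ) :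
    ∑ k ∈ Finset.range N, y ^ (m + k + 1) / ((m : ℂ) + k + 1 / 2) ^ p
      = cycOddHarmonicInt p y (m + N) - cycOddHarmonicInt p y m := by
  induction N with
  | zero => simp
  | succ N ih =>
    have h1 : m + ((N + 1 : ℕ) : ℤ) = (m + N) + 1 := by push_cast; ring
    rw [Finset.sum_range_succ, ih, h1, cycOddHarmonicInt_succ p hy]
    push_cast
    ring

lemma zpow_mul_sum_range (p : ℕ) {y : ℂ} (hy : y ≠ 0) (m : ℤ) (M : ℕ) :
    y ^ m * ∑ k ∈ Finset.range (M + 1), y ^ k * (((m : ℂ) + ((k : ℂ) + 1 / 2))⁻¹) ^ p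
      = y⁻¹ * (cycOddHarmonicInt p y (m + (M + 1 : ℕ)) - cycOddHarmonicInt p y m) := by
  rw [← sum_range_eq_cycOddHarmonicInt_sub p hy, Finset.mul_sum, Finset.mul_sum]
  refine Finset.sum_congr rfl fun k _ => ?_
  rw [zpow_add₀ hy, zpow_add₀ hy, zpow_natCast, zpow_one, inv_pow, ← add_assoc, div_eq_mul_inv]
  field_simp

/-- With its term m = 0 restored, the symmetric sum over |m| ≤ N telescopes along the recurrence;
the translation by n costs a factor y^(-n). -/
lemma sum_symm_eq_cycOddHarmonicInt_sub (p : ℕ) {y : ℂ} (hy : y ≠ 0) (n N : ℕ) :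
    ∑ m ∈ Finset.Icc 1 N, (y ^ m * (((m : ℂ) + ((n : ℂ) + 1 / 2))⁻¹) ^ p +
        y⁻¹ ^ m * ((-(m : ℂ) + ((n : ℂ) + 1 / 2))⁻¹) ^ p)
      = (y⁻¹) ^ n * (y⁻¹ * (cycOddHarmonicInt p y ((N : ℤ) + n + 1)
          - cycOddHarmonicInt p y ((n : ℤ) - N))) - (((n : ℂ) + 1 / 2) ^ p)⁻¹ := by
  induction N with
  | zero =>
    have h := cycOddHarmonicInt_succ p hy n
    simp only [Nat.cast_zero, zero_add, sub_zero]
    rw [h, add_sub_cancel_left, zpow_add₀ hy, zpow_natCast, zpow_one, inv_pow]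
    push_cast
    simp
    field_simp
    ring
  | succ N ih =>
    have h1 := cycOddHarmonicInt_succ p hy ((N : ℤ) + n + 1)
    have h2 := cycOddHarmonicInt_succ p hy ((n : ℤ) - ((N + 1 : ℕ) : ℤ))
    have e1 : ((N + 1 : ℕ) : ℤ) + n + 1 = (N : ℤ) + n + 1 + 1 := by push_cast; ring
    have e2 : (n : ℤ) - ((N + 1 : ℕ) : ℤ) + 1 = n - N := by push_cast; ring
    rw [e2] at h2
    have h3 : y ^ ((N : ℤ) + n + 1 + 1) = y ^ (N + 1) * y ^ n * y := by
      rw [← zpow_natCast, ← zpow_natCast, ← zpow_add₀ hy, ← zpow_add_one₀ hy]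
      congr 1
      push_cast
      ring
    have h4 : y ^ ((n : ℤ) - N) = (y⁻¹) ^ (N + 1) * y ^ n * y := by
      rw [inv_pow, ← zpow_natCast y, ← zpow_natCast y, ← zpow_neg, ← zpow_add₀ hy,
        ← zpow_add_one₀ hy]
      congr 1
      push_cast
      ring
    rw [h3] at h1
    rw [h4] at h2
    have e3 : (((N : ℤ) + n + 1 : ℤ) : ℂ) + 1 / 2 = ((N + 1 : ℕ) : ℂ) + ((n : ℂ) + 1 / 2) := by
      push_cast; ring
    have e4 : (((n : ℤ) - ((N + 1 : ℕ) : ℤ) : ℤ) : ℂ) + 1 / 2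
        = -((N + 1 : ℕ) : ℂ) + ((n : ℂ) + 1 / 2) := by
      push_cast; ring
    rw [e3] at h1
    rw [e4] at h2
    have h5 : (y⁻¹) ^ n * y ^ n = 1 := by rw [← mul_pow, inv_mul_cancel₀ hy, one_pow]
    have h6 : y⁻¹ * y = 1 := inv_mul_cancel₀ hy
    rw [Finset.sum_Icc_succ_top (by omega), ih, e1, h1, h2]
    simp only [inv_pow _ p, div_eq_mul_inv]
    linear_combination (- y ^ (N + 1) * ((((N + 1 : ℕ) : ℂ) + ((n : ℂ) + 1 * 2⁻¹)) ^ p)⁻¹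
      - y⁻¹ ^ (N + 1) * ((-((N + 1 : ℕ) : ℂ) + ((n : ℂ) + 1 * 2⁻¹)) ^ p)⁻¹) *
      (h5 * (y⁻¹ * y) + h6)

lemma IsTame.cycOddHarmonicInt_pos {p : ℕ} {y T : ℂ} {K : ℝ}
    (hT : ∀ n : ℕ, ‖cycOddHarmonic p y n - T‖ ≤ K / (n + 1)) :
    IsTame (fun M n => cycOddHarmonicInt p y ((n : ℤ) + (M + 1 : ℕ)) - cycOddHarmonicInt p y n)
      (fun n => T - cycOddHarmonic p y n) := by
  have hK : 0 ≤ K := by simpa using (norm_nonneg _).trans (hT 0)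
  have h1 : IsTame (fun M n => cycOddHarmonic p y (n + M + 1)) (fun _ => T) := by
    refine ⟨fun n => (tendsto_of_tail_bound hT).comp ?_, T, T, K, fun M n => ?_⟩
    · exact tendsto_atTop_mono (fun M => by show M ≤ n + M + 1; omega) tendsto_id
    · rw [ite_self]
      refine (hT _).trans ?_
      rw [mul_add, mul_one_div]
      have h2 : 0 ≤ K * (1 / (|(M : ℝ) - n| + 1)) := by positivity
      have h3 : K / (((n + M + 1 : ℕ) : ℝ) + 1) ≤ K / ((n : ℝ) + 1) := by
        gcongr
        have : (0 : ℝ) ≤ M := by positivity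
        linarith
      linarith
  have h2 := h1.add ((IsTame.const (-1)).mul (IsTame.of_tail hT))
  convert h2 using 3 with M n
  · have : ((n : ℤ) + ((M + 1 : ℕ) : ℤ)) = ((n + M + 1 : ℕ) : ℤ) := by push_cast; ring
    rw [this, cycOddHarmonicInt_natCast, cycOddHarmonicInt_natCast]
    ring
  · ring

/-- The index M + 1 - n changes sign as n passes M, so the shifted number is near T before and near
(-1)^(p+1) y T' after. This jump is what the two constants in `IsTame` allow for. -/
lemma IsTame.cycOddHarmonicInt_neg {p : ℕ} {y T T' : ℂ} {K K' : ℝ}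
    (hT : ∀ n : ℕ, ‖cycOddHarmonic p y n - T‖ ≤ K / (n + 1))
    (hT' : ∀ n : ℕ, ‖cycOddHarmonic p y⁻¹ n - T'‖ ≤ K' / (n + 1)) :
    IsTame (fun M n => cycOddHarmonicInt p y (-(n : ℤ) + (M + 1 : ℕ))
        - cycOddHarmonicInt p y (-(n : ℤ)))
      (fun n => T - (-1) ^ (p + 1) * y * cycOddHarmonic p y⁻¹ n) := by
  have hK : 0 ≤ K := by simpa using (norm_nonneg _).trans (hT 0)
  have hK' : 0 ≤ K' := by simpa using (norm_nonneg _).trans (hT' 0)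
  have h1 : IsTame (fun M n => cycOddHarmonicInt p y (-(n : ℤ) + (M + 1 : ℕ))) (fun _ => T) := by
    refine ⟨fun n => ?_, T, (-1) ^ (p + 1) * y * T', K + 2 * (‖y‖ * K'), fun M n => ?_⟩
    · refine ((tendsto_of_tail_bound hT).comp
        ((tendsto_add_atTop_nat 1).comp (tendsto_sub_atTop_nat n))).congr' ?_
      filter_upwards [eventually_ge_atTop n] with M hM
      have : (-(n : ℤ) + ((M + 1 : ℕ) : ℤ)) = ((M - n + 1 : ℕ) : ℤ) := by omega
      rw [this, cycOddHarmonicInt_natCast]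
      rfl
    · have hn0 : 0 < 1 / ((n : ℝ) + 1) := by positivity
      have hg : 0 < 1 / (|(M : ℝ) - n| + 1) := by positivity
      have hyK : 0 ≤ ‖y‖ * K' := by positivity
      split_ifs with h
      · have : (-(n : ℤ) + ((M + 1 : ℕ) : ℤ)) = ((M - n + 1 : ℕ) : ℤ) := by omega
        beta_reduce
        rw [this, cycOddHarmonicInt_natCast]
        have h2 : K / (((M - n + 1 : ℕ) : ℝ) + 1) ≤ K * (1 / (|(M : ℝ) - n| + 1)) := by
          rw [mul_one_div, Nat.cast_add, Nat.cast_sub h, abs_of_nonneg (by simpa using h)]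
          have : (0 : ℝ) ≤ (M : ℝ) - n := by simpa using h
          gcongr
          simp
        refine (hT _).trans (h2.trans ?_)
        refine mul_le_mul (by linarith) (by linarith) hg.le (by positivity)
      · have : (-(n : ℤ) + ((M + 1 : ℕ) : ℤ)) = -((n - M - 1 : ℕ) : ℤ) := by omega
        beta_reduce
        rw [this, cycOddHarmonicInt_neg_natCast, ← mul_sub, norm_mul, norm_mul, norm_pow, norm_neg,
          norm_one, one_pow, one_mul]
        have h2 : K' / (((n - M - 1 : ℕ) : ℝ) + 1) ≤ 2 * K' * (1 / (|(M : ℝ) - n| + 1)) := by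
          obtain ⟨d, rfl⟩ := Nat.exists_eq_add_of_lt (not_le.1 h)
          have e1 : M + d + 1 - M - 1 = d := by omega
          have e2 : |(M : ℝ) - ((M + d + 1 : ℕ) : ℝ)| = (d : ℝ) + 1 := by
            have e3 : (M : ℝ) - ((M + d + 1 : ℕ) : ℝ) = -((d : ℝ) + 1) := by push_cast; ring
            rw [e3, abs_neg, abs_of_nonneg (by positivity)]
          rw [e1, e2, mul_one_div, div_le_div_iff₀ (by positivity) (by positivity)]
          have : 0 ≤ K' * d := by positivity
          nlinarith
        calc ‖y‖ * ‖cycOddHarmonic p y⁻¹ (n - M - 1) - T'‖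
            ≤ ‖y‖ * (2 * K' * (1 / (|(M : ℝ) - n| + 1))) := by
              gcongr
              exact (hT' _).trans h2
          _ = 2 * (‖y‖ * K') * (1 / (|(M : ℝ) - n| + 1)) := by ring
          _ ≤ _ := mul_le_mul (by linarith) (by linarith) hg.le (by positivity)
  have h2 := h1.add ((IsTame.const (-((-1) ^ (p + 1) * y))).mul (IsTame.of_tail hT'))
  convert h2 using 3 with M n
  · rw [cycOddHarmonicInt_neg_natCast]
    ring
  · ring

/-! ### Two-sided sums of the kernel. -/

section SymmetricSums

variable {r : ℕ} {A : Subalgebra ℚ ℂ}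

lemma tendsto_cycOddHarmonic_one_add_sub (d : ℕ) :
    Tendsto (fun N => cycOddHarmonic 1 1 (N + d) - cycOddHarmonic 1 1 N) atTop (𝓝 0) := by
  have h0 : Tendsto (fun N : ℕ => 1 / ((N : ℂ) + 1 / 2)) atTop (𝓝 0) := by
    rw [tendsto_zero_iff_norm_tendsto_zero]
    refine squeeze_zero (fun _ => norm_nonneg _) (fun N => ?_)
      (by simpa using (tendsto_one_div_add_atTop_nhds_zero_nat (𝕜 := ℝ)).const_mul 2)
    have := half_weight_bound (z := 1) norm_one le_rfl N
    simpa [div_eq_mul_inv] using this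
  induction d with
  | zero => simp
  | succ d ih =>
    have h1 := ih.add (h0.comp (tendsto_add_atTop_nat d))
    rw [add_zero] at h1
    refine h1.congr fun N => ?_
    rw [← add_assoc, cycOddHarmonic_succ]
    simp only [Function.comp, one_pow, pow_one]
    ring

/-- The limit D does not depend on n. In the divergent case i = 1, X = 1, the extended numbers are
even in the index, so symmetric summation leaves t_{N+n+1} - t_{N-n}, which tends to 0. -/
lemma exists_limit_cycOddHarmonicInt_sub (hr : 1 ≤ r) (hA : lowerOrderSums r ⊆ A) {X : ℂ}
    (hX : IsOfFinOrder X) (hXA : X ∈ A) (hXA' : X⁻¹ ∈ A) {i : ℕ} (hi : 1 ≤ i) :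
    ∃ D ∈ A, ∀ n : ℕ, Tendsto (fun N : ℕ => cycOddHarmonicInt i X ((N : ℤ) + n + 1)
      - cycOddHarmonicInt i X ((n : ℤ) - N)) atTop (𝓝 D) := by
  have hpos : ∀ N n : ℕ, cycOddHarmonicInt i X ((N : ℤ) + n + 1)
      = cycOddHarmonic i X (N + n + 1) := by
    intro N n
    rw [← cycOddHarmonicInt_natCast]
    push_cast
    rfl
  have hneg : ∀ N n : ℕ, n ≤ N → cycOddHarmonicInt i X ((n : ℤ) - N)
      = (-1) ^ (i + 1) * X * cycOddHarmonic i X⁻¹ (N - n) := by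
    intro N n h
    rw [← cycOddHarmonicInt_neg_natCast, Nat.cast_sub h, neg_sub]
  by_cases hiX : (i, X) = (1, 1)
  · rw [Prod.mk.injEq] at hiX
    obtain ⟨rfl, rfl⟩ := hiX
    refine ⟨0, zero_mem A, fun n => ?_⟩
    refine ((tendsto_cycOddHarmonic_one_add_sub (2 * n + 1)).comp
      (tendsto_sub_atTop_nat n)).congr' ?_
    filter_upwards [eventually_ge_atTop n] with N hN
    rw [hpos, hneg N n hN, Function.comp, show N - n + (2 * n + 1) = N + n + 1 by omega]
    norm_num
  · obtain ⟨T, K, hT⟩ := cycOddHarmonic_tail hi hX.norm_eq_one hiX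
    obtain ⟨T', K', hT'⟩ := cycOddHarmonic_tail hi hX.inv_complex.norm_eq_one
      (exponent_arg_inv hiX)
    have hT := tendsto_of_tail_bound hT
    have hT' := tendsto_of_tail_bound hT'
    have hTA := cycOddHarmonic_limit_mem hr hA hi hX hiX hXA hT
    have hTA' := cycOddHarmonic_limit_mem hr hA hi hX.inv_complex (exponent_arg_inv hiX) hXA' hT'
    refine ⟨T - (-1) ^ (i + 1) * X * T',
      sub_mem hTA (mul_mem (mul_mem (neg_one_pow_mem_subalgebra _) hXA) hTA'), fun n => ?_⟩
    refine ((hT.comp (tendsto_add_atTop_nat (n + 1))).sub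
      ((hT'.comp (tendsto_sub_atTop_nat n)).const_mul ((-1) ^ (i + 1) * X))).congr' ?_
    filter_upwards [eventually_ge_atTop n] with N hN
    rw [hpos, hneg N n hN]
    rfl

lemma exists_limit_symm_half (hr : 1 ≤ r) (hA : lowerOrderSums r ⊆ A) {X : ℂ}
    (hX : IsOfFinOrder X) (hXA : X ∈ A) (hXA' : X⁻¹ ∈ A) {i : ℕ} (hi : 1 ≤ i) :
    ∃ D ∈ A, ∀ n : ℕ, Tendsto (fun N : ℕ => ∑ m ∈ Finset.Icc 1 N,
      (X ^ m * (((m : ℂ) + ((n : ℂ) + 1 / 2))⁻¹) ^ i +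
        X⁻¹ ^ m * ((-(m : ℂ) + ((n : ℂ) + 1 / 2))⁻¹) ^ i)) atTop
      (𝓝 ((X⁻¹) ^ n * D - (((n : ℂ) + 1 / 2) ^ i)⁻¹)) := by
  obtain ⟨D, hDA, hD⟩ := exists_limit_cycOddHarmonicInt_sub hr hA hX hXA hXA' hi
  refine ⟨X⁻¹ * D, mul_mem hXA' hDA, fun n => ?_⟩
  simp only [sum_symm_eq_cycOddHarmonicInt_sub i hX.ne_zero_complex n]
  exact (((hD n).const_mul _).const_mul _).sub_const _

lemma exists_limit_symm_int (hr : 1 ≤ r) (hA : lowerOrderSums r ⊆ A) {X : ℂ}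
    (hX : IsOfFinOrder X) {i : ℕ} (hi : 1 ≤ i) :
    ∃ E ∈ A, Tendsto (fun N : ℕ => ∑ m ∈ Finset.Icc 1 N,
      (X ^ m * ((m : ℂ)⁻¹) ^ i + X⁻¹ ^ m * ((-(m : ℂ))⁻¹) ^ i)) atTop (𝓝 E) := by
  by_cases hiX : (i, X) = (1, 1)
  · rw [Prod.mk.injEq] at hiX
    obtain ⟨rfl, rfl⟩ := hiX
    refine ⟨0, zero_mem A, ?_⟩
    simp
  · obtain ⟨T, K, hT⟩ := cycHarmonic_tail hi hX.norm_eq_one hiX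
    obtain ⟨T', K', hT'⟩ := cycHarmonic_tail hi hX.inv_complex.norm_eq_one (exponent_arg_inv hiX)
    have hT := tendsto_of_tail_bound hT
    have hT' := tendsto_of_tail_bound hT'
    refine ⟨T + (-1) ^ i * T', add_mem (cycHarmonic_limit_mem hr hA hi hX hiX hT)
      (mul_mem (neg_one_pow_mem_subalgebra _) (cycHarmonic_limit_mem hr hA hi hX.inv_complex
        (exponent_arg_inv hiX) hT')), (hT.add (hT'.const_mul _)).congr fun N => ?_⟩
    rw [cycHarmonic, cycHarmonic, Finset.mul_sum, ← Finset.sum_add_distrib]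
    refine Finset.sum_congr rfl fun m _ => ?_
    rw [inv_neg, neg_pow ((m : ℂ)⁻¹), inv_pow (m : ℂ), div_eq_mul_inv, div_eq_mul_inv]
    ring

/-- The rational function `s⁻ᑫ ∏ⱼ ∑_{k ≤ M} yⱼᵏ / (s + k + 1/2)^{pⱼ}`. -/
noncomputable def truncatedKernel (p : Fin r → ℕ) (q : ℕ) (y : Fin r → ℂ) (M : ℕ) (s : ℂ) : ℂ :=
  (s⁻¹) ^ q * ∏ j, ∑ k ∈ Finset.range (M + 1), y j ^ k * ((s + ((k : ℂ) + 1 / 2))⁻¹) ^ p j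

lemma natCast_add_half_ne_zero (n : ℕ) : (n : ℂ) + 1 / 2 ≠ 0 := by
  intro h
  have h1 : (2 * n + 1 : ℂ) = 0 := by linear_combination 2 * h
  have h2 : 2 * n + 1 = 0 := by exact_mod_cast h1
  omega

lemma intCast_add_half_ne_zero (m : ℤ) (n : ℕ) : (m : ℂ) + ((n : ℂ) + 1 / 2) ≠ 0 := by
  intro h
  have h1 : (2 * m + 2 * n + 1 : ℂ) = 0 := by linear_combination 2 * h
  have h2 : 2 * m + 2 * n + 1 = 0 := by exact_mod_cast h1
  omega

/-- The two-sided sum of the truncated kernel converges, and its limit as `M → ∞` is a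
combination of lower order sums. -/
lemma exists_limit_truncatedKernel (hr : 1 ≤ r) (hA : lowerOrderSums r ⊆ A) {p : Fin r → ℕ}
    {q : ℕ} {y : Fin r → ℂ} {x : ℂ} (hp : ∀ j, 1 ≤ p j) (hq : 1 ≤ q)
    (hy : ∀ j, IsOfFinOrder (y j)) (hx : IsOfFinOrder x) (hyA : ∀ j, y j ∈ A)
    (hyA' : ∀ j, (y j)⁻¹ ∈ A) (hxA : x ∈ A) (hxA' : x⁻¹ ∈ A)
    (hpy : ∀ j, (p j, y j) ≠ (1, 1)) (hqx : (q, x) ≠ (1, 1)) :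
    ∃ (V : ℕ → ℂ) (V' : ℂ), V' ∈ A ∧ Tendsto V atTop (𝓝 V') ∧
      ∀ M, Tendsto (fun N : ℕ => ∑ m ∈ Finset.Icc 1 N,
        ((x * ∏ j, y j) ^ m * truncatedKernel p q y M m
          + (x * ∏ j, y j)⁻¹ ^ m * truncatedKernel p q y M (-m))) atTop (𝓝 (V M)) := by
  set X := x * ∏ j, y j with hXdef
  set P := ∑ j, p j with hP
  have hYfin : IsOfFinOrder (∏ j, y j) := IsOfFinOrder.prod_complex _ fun j _ => hy j
  have hX : IsOfFinOrder X := (Commute.all _ _).isOfFinOrder_mul hx hYfin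
  have hXA : X ∈ A := mul_mem hxA (prod_mem fun j _ => hyA j)
  have hXA' : X⁻¹ ∈ A := by
    rw [hXdef, mul_inv, ← Finset.prod_inv_distrib]
    exact mul_mem hxA' (prod_mem fun j _ => hyA' j)
  have hzX : (∏ j, y j) * X⁻¹ = x⁻¹ := by
    rw [hXdef, mul_inv, mul_left_comm, mul_inv_cancel₀ hYfin.ne_zero_complex, mul_one]
  choose D hDA hD using fun i : ℕ =>
    exists_limit_symm_half hr hA hX hXA hXA' (Nat.le_add_left 1 i)
  choose E hEA hE using fun i : ℕ => exists_limit_symm_int hr hA hX (Nat.le_add_left 1 i)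
  choose c' hc'A hc' using fun t =>
    exists_limit_coeff_at_zero hr hA hp hy hyA hyA' hpy t
  set c : ℕ → ℕ → ℂ := fun M t => PowerSeries.coeff t (∏ j, ∑ k ∈ Finset.range (M + 1),
      PowerSeries.C (y j ^ k) * invPowSeries (p j) ((k : ℂ) + 1 / 2)) with hc
  set d : ℕ → ℕ → ℕ → ℂ := fun M n t =>
    PowerSeries.coeff t (invPowSeries q (-((n : ℂ) + 1 / 2)) *
        ∏ j, (1 + PowerSeries.X ^ p j * ∑ k ∈ (Finset.range (M + 1)).erase n,
          PowerSeries.C (y j ^ k / y j ^ n) *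
            invPowSeries (p j) (((k : ℂ) + 1 / 2) - ((n : ℂ) + 1 / 2)))) with hd
  have hd1 : ∀ i ∈ Finset.range P, ∃ L ∈ A, Tendsto (fun M => ∑ n ∈ Finset.range (M + 1),
      x⁻¹ ^ n / ((n : ℂ) + 1 / 2) ^ 0 * d M n (P - 1 - i)) atTop (𝓝 L) := fun i hi =>
    exists_limit_sum_coeff hA hp hy hpy hq (by have := Finset.mem_range.1 hi; omega)
      hx.inv_complex 0 (exponent_arg_inv hqx)
  have hd2 : ∀ i ∈ Finset.range P, ∃ L ∈ A, Tendsto (fun M => ∑ n ∈ Finset.range (M + 1),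
      (∏ j, y j) ^ n / ((n : ℂ) + 1 / 2) ^ (i + 1) * d M n (P - 1 - i)) atTop (𝓝 L) :=
    fun i hi => exists_limit_sum_coeff hA hp hy hpy hq
      (by have := Finset.mem_range.1 hi; omega) hYfin (i + 1) (fun h => by
        rw [Prod.mk.injEq] at h
        omega)
  choose! L1 hL1A hL1 using hd1
  choose! L2 hL2A hL2 using hd2
  have ha : Function.Injective (fun n : ℕ => (n : ℂ) + 1 / 2) := fun a b h => by simpa using h
  have hpf : ∀ (M : ℕ) (m : ℤ), m ≠ 0 → truncatedKernel p q y M m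
      = ∑ i ∈ Finset.range q, c M (q - 1 - i) * ((m : ℂ)⁻¹) ^ (i + 1)
        + ∑ n ∈ Finset.range (M + 1), ∑ i ∈ Finset.range P,
          ((∏ j, y j) ^ n * d M n (P - 1 - i)) *
            (((m : ℂ) + ((n : ℂ) + 1 / 2))⁻¹) ^ (i + 1) := by
    intro M m hm
    rw [truncatedKernel, partial_fraction_expansion (fun j => (hy j).ne_zero_complex) hp hq ha
      natCast_add_half_ne_zero M (Int.cast_ne_zero.2 hm) (intCast_add_half_ne_zero m)]
    simp only [PowerSeries.coeff_C_mul, hc, hd, hP]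
  -- For fixed M the expansion is finite, so the sum over m acts on each principal part separately.
  -- In the limit, Y^n X^(-n) = x^(-n) gives the sums `L1`, and the omitted terms m = 0 give `L2`.
  refine ⟨fun M => ∑ i ∈ Finset.range q, c M (q - 1 - i) * E i
      + ∑ n ∈ Finset.range (M + 1), ∑ i ∈ Finset.range P,
          ((∏ j, y j) ^ n * d M n (P - 1 - i)) *
            ((X⁻¹) ^ n * D i - (((n : ℂ) + 1 / 2) ^ (i + 1))⁻¹),
    ∑ i ∈ Finset.range q, c' (q - 1 - i) * E i + ∑ i ∈ Finset.range P, (D i * L1 i - L2 i),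
    ?_, ?_, fun M => ?_⟩
  · exact add_mem (sum_mem fun i _ => mul_mem (hc'A _) (hEA i))
      (sum_mem fun i hi => sub_mem (mul_mem (hDA i) (hL1A i hi)) (hL2A i hi))
  · refine (tendsto_finsetSum _ fun i _ => (hc' _).mul_const (E i)).add ?_
    refine (tendsto_finsetSum _ fun i hi =>
      ((hL1 i hi).const_mul (D i)).sub (hL2 i hi)).congr fun M => ?_
    rw [Finset.sum_comm]
    refine Finset.sum_congr rfl fun i _ => ?_
    rw [Finset.mul_sum, ← Finset.sum_sub_distrib]
    refine Finset.sum_congr rfl fun n _ => ?_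
    rw [← hzX, mul_pow, pow_zero, div_one, div_eq_mul_inv]
    ring
  · refine ((tendsto_finsetSum (Finset.range q) fun i _ => (hE i).const_mul (c M (q - 1 - i))).add
      (tendsto_finsetSum (Finset.range (M + 1)) fun n _ =>
        tendsto_finsetSum (Finset.range P) fun i _ =>
          (hD i n).const_mul ((∏ j, y j) ^ n * d M n (P - 1 - i)))).congr fun N => ?_
    simp only [Finset.mul_sum]
    have hswap : ∀ f : ℕ → ℕ → ℕ → ℂ,
        ∑ n ∈ Finset.range (M + 1), ∑ i ∈ Finset.range P, ∑ m ∈ Finset.Icc 1 N, f n i m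
        = ∑ m ∈ Finset.Icc 1 N, ∑ n ∈ Finset.range (M + 1), ∑ i ∈ Finset.range P, f n i m := by
      intro f
      rw [Finset.sum_comm (s := Finset.Icc 1 N)]
      exact Finset.sum_congr rfl fun n _ => Finset.sum_comm
    rw [hswap, Finset.sum_comm (s := Finset.range q), ← Finset.sum_add_distrib]
    refine Finset.sum_congr rfl fun m hm => ?_
    have hm1 : 1 ≤ m := (Finset.mem_Icc.1 hm).1
    have h1 := hpf M m (by omega)
    have h2 := hpf M (-m) (by omega)
    push_cast at h1 h2
    rw [h1, h2]
    simp only [mul_add, Finset.sum_add_distrib, Finset.mul_sum]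
    have e1 : ∀ (u v w : ℂ), u * (v * w) = v * (u * w) := fun u v w => by ring
    simp only [e1 (X ^ m), e1 (X⁻¹ ^ m)]
    ring

end SymmetricSums

/-! ### Comparison of the two evaluations. -/

section Main

variable {r : ℕ} {A : Subalgebra ℚ ℂ}

lemma sub_top_term_mem {ι : Type*} [Fintype ι] {w : ℕ → ℂ} {h : ι → ℕ → ℂ}
    {c s : ι → ℂ} (hc : ∀ j, c j ∈ A) (hs : ∀ j, s j ∈ A) {L : Finset ι → ℂ}
    (hL : ∀ I, Tendsto (fun N => ∑ n ∈ Finset.range N, w n * ∏ j ∈ I, h j n) atTop (𝓝 (L I)))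
    (hLA : ∀ I, I ≠ Finset.univ → L I ∈ A) {S : ℂ}
    (hS : Tendsto (fun N => ∑ n ∈ Finset.range N, w n * ∏ j, (s j * h j n + c j)) atTop (𝓝 S)) :
    S - (∏ j, s j) * L Finset.univ ∈ A := by
  classical
  rw [tendsto_nhds_unique hS (tendsto_sum_prod_expand Finset.univ c s fun I _ => hL I),
    ← Finset.add_sum_erase _ _ (Finset.mem_powerset_self _), Finset.sdiff_self,
    Finset.prod_empty, mul_one, add_sub_cancel_left]
  refine sum_mem fun I hI => mul_mem (mul_mem (prod_mem fun j _ => hs j)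
    (prod_mem fun j _ => hc j)) (hLA I (Finset.ne_of_mem_erase hI))

lemma exists_tildeSSum_limits (hA : lowerOrderSums r ⊆ A) {p : Fin r → ℕ} {q : ℕ}
    {y : Fin r → ℂ} {x : ℂ} (hp : ∀ j, 1 ≤ p j) (hq : 1 ≤ q)
    (hy : ∀ j, IsOfFinOrder (y j)) (hx : IsOfFinOrder x)
    (hpy : ∀ j, (p j, y j) ≠ (1, 1)) (hqx : (q, x) ≠ (1, 1)) :
    ∃ L : Finset (Fin r) → ℂ, (∀ I, Tendsto (fun N => ∑ n ∈ Finset.range N,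
      x ^ n / (n : ℂ) ^ q * ∏ j ∈ I, cycOddHarmonic (p j) (y j) n) atTop (𝓝 (L I))) ∧
      (∀ I, I ≠ Finset.univ → L I ∈ A) := by
  obtain ⟨W, hW⟩ := weight_tendsto hx hq hqx
  choose T K hT using fun j => cycOddHarmonic_tail (hp j) (hy j).norm_eq_one (hpy j)
  have h1 : ∀ I : Finset (Fin r), ∃ L, Tendsto (fun N => ∑ n ∈ Finset.range N,
      x ^ n / (n : ℂ) ^ q * ∏ j ∈ I, cycOddHarmonic (p j) (y j) n) atTop (𝓝 L) := by
    intro I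
    obtain ⟨-, L, -, -, hL⟩ := (IsTame.prod I fun j _ => IsTame.of_tail (hT j)).tendsto_sum hW
      (weight_bound hx.norm_eq_one hq)
    exact ⟨L, hL⟩
  choose L hL using h1
  refine ⟨L, hL, fun I hI => tildeSSum_mem hA ?_ hp hy hx hq hqx (hL I)⟩
  have := Finset.card_lt_univ_of_notMem (s := I)
    (not_forall.1 fun h => hI (Finset.eq_univ_iff_forall.2 h)).choose_spec
  simpa using this

lemma isTildeSSum_of_tendsto {p : Fin r → ℕ} {q : ℕ} (hq : 1 ≤ q) {y : Fin r → ℂ} {x z : ℂ}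
    (h : Tendsto (fun N => ∑ n ∈ Finset.range N,
      x ^ n / (n : ℂ) ^ q * ∏ j, cycOddHarmonic (p j) (y j) n) atTop (𝓝 z)) :
    IsTildeSSum p q y x z := by
  refine (h.comp (tendsto_add_atTop_nat 1)).congr fun N => ?_
  rw [Function.comp, sum_range_succ_weight x hq]
  exact Finset.sum_congr rfl fun n _ => by ring

/-- The truncated kernel in terms of the two-sided odd harmonic numbers. -/
lemma zpow_mul_truncatedKernel {p : Fin r → ℕ} (q : ℕ) {y : Fin r → ℂ} {x : ℂ}
    (hy : ∀ j, y j ≠ 0) (M : ℕ) (m : ℤ) :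
    (x * ∏ j, y j) ^ m * truncatedKernel p q y M m
      = (∏ j, y j)⁻¹ * (x ^ m * ((m : ℂ)⁻¹) ^ q *
        ∏ j, (cycOddHarmonicInt (p j) (y j) (m + (M + 1 : ℕ))
          - cycOddHarmonicInt (p j) (y j) m)) := by
  have h1 := Finset.prod_congr rfl fun j (_ : j ∈ Finset.univ) =>
    zpow_mul_sum_range (p j) (hy j) m M
  rw [Finset.prod_mul_distrib, Finset.prod_mul_distrib, Finset.prod_inv_distrib] at h1
  rw [truncatedKernel, mul_zpow, ← Finset.prod_zpow]
  linear_combination (x ^ m * ((m : ℂ)⁻¹) ^ q) * h1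

lemma tildeSSum_parity (hr : 1 ≤ r) (hA : lowerOrderSums r ⊆ A) {p : Fin r → ℕ}
    {q : ℕ} {y : Fin r → ℂ} {x : ℂ} (hp : ∀ j, 1 ≤ p j) (hq : 1 ≤ q)
    (hy : ∀ j, IsOfFinOrder (y j)) (hx : IsOfFinOrder x) (hyA : ∀ j, y j ∈ A)
    (hyA' : ∀ j, (y j)⁻¹ ∈ A) (hxA : x ∈ A) (hxA' : x⁻¹ ∈ A)
    (hpy : ∀ j, (p j, y j) ≠ (1, 1)) (hqx : (q, x) ≠ (1, 1)) :
    ∃ a b : ℂ, IsTildeSSum p q y x a ∧ IsTildeSSum p q (fun j => (y j)⁻¹) x⁻¹ b ∧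
      (∏ j, y j)⁻¹ * a + (-1) ^ ((∑ j, p j) + q + r) * b ∈ A := by
  obtain ⟨L, hL, hLA⟩ := exists_tildeSSum_limits hA hp hq hy hx hpy hqx
  obtain ⟨L', hL', hLA'⟩ := exists_tildeSSum_limits hA hp hq (fun j => (hy j).inv_complex)
    hx.inv_complex (fun j => exponent_arg_inv (hpy j)) (exponent_arg_inv hqx)
  refine ⟨L Finset.univ, L' Finset.univ, isTildeSSum_of_tendsto hq (hL _),
    isTildeSSum_of_tendsto hq (hL' _), ?_⟩
  obtain ⟨V, V', hV'A, hVV', hV⟩ :=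
    exists_limit_truncatedKernel hr hA hp hq hy hx hyA hyA' hxA hxA' hpy hqx
  choose T K hT using fun j => cycOddHarmonic_tail (hp j) (hy j).norm_eq_one (hpy j)
  choose T' K' hT' using fun j => cycOddHarmonic_tail (hp j) (hy j).inv_complex.norm_eq_one
    (exponent_arg_inv (hpy j))
  have hTA : ∀ j, T j ∈ A := fun j => cycOddHarmonic_limit_mem hr hA (hp j) (hy j) (hpy j) (hyA j)
    (tendsto_of_tail_bound (hT j))
  obtain ⟨W, hW⟩ := weight_tendsto hx hq hqx
  obtain ⟨W', hW'⟩ := weight_tendsto hx.inv_complex hq (exponent_arg_inv hqx)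
  obtain ⟨S, S', hS, hSS', hS'⟩ := (IsTame.prod Finset.univ fun j _ =>
    IsTame.cycOddHarmonicInt_pos (hT j)).tendsto_sum hW (weight_bound hx.norm_eq_one hq)
  obtain ⟨R, R', hR, hRR', hR'⟩ := (IsTame.prod Finset.univ fun j _ =>
    IsTame.cycOddHarmonicInt_neg (hT j) (hT' j)).tendsto_sum hW'
      (weight_bound hx.inv_complex.norm_eq_one hq)
  have hVeq : ∀ M, V M = (∏ j, y j)⁻¹ * (S M + (-1) ^ q * R M) := by
    intro M
    refine tendsto_nhds_unique (hV M) ?_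
    refine ((((hS M).comp (tendsto_add_atTop_nat 1)).add
      (((hR M).comp (tendsto_add_atTop_nat 1)).const_mul ((-1) ^ q))).const_mul
        ((∏ j, y j)⁻¹)).congr fun N => ?_
    simp only [Function.comp]
    rw [sum_range_succ_weight x hq, sum_range_succ_weight x⁻¹ hq, Finset.mul_sum (a := (-1) ^ q),
      ← Finset.sum_add_distrib, Finset.mul_sum]
    refine Finset.sum_congr rfl fun m _ => ?_
    have h1 := zpow_mul_truncatedKernel (p := p) q (x := x)
      (fun j => (hy j).ne_zero_complex) M m
    have h2 := zpow_mul_truncatedKernel (p := p) q (x := x)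
      (fun j => (hy j).ne_zero_complex) M (-m)
    rw [zpow_natCast, zpow_natCast, Int.cast_natCast] at h1
    rw [zpow_neg, zpow_natCast, ← inv_pow, zpow_neg, zpow_natCast, ← inv_pow, Int.cast_neg,
      Int.cast_natCast, inv_neg, neg_pow ((m : ℂ)⁻¹)] at h2
    rw [h1, h2, div_eq_mul_inv, div_eq_mul_inv, inv_pow (m : ℂ)]
    ring
  have hV'eq : V' = (∏ j, y j)⁻¹ * (S' + (-1) ^ q * R') := by
    refine tendsto_nhds_unique hVV' ?_
    simp only [funext hVeq]
    exact (hSS'.add (hRR'.const_mul _)).const_mul _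
  -- The top coefficient is (-1)^r for positive m and ∏ (-1)^(p_j) y_j for negative m, the latter
  -- from T - (-1)^(p+1) y t = T + (-1)^p y t.
  have m1 : S' - (∏ _j : Fin r, (-1)) * L Finset.univ ∈ A := by
    refine sub_top_term_mem hTA (fun _ => neg_mem (one_mem A)) hL hLA (hS'.congr fun N => ?_)
    refine Finset.sum_congr rfl fun n _ => ?_
    congr 1
    exact Finset.prod_congr rfl fun j _ => by ring
  have m2 : R' - (∏ j, ((-1) ^ p j * y j)) * L' Finset.univ ∈ A := by
    refine sub_top_term_mem hTA (fun j => mul_mem (neg_one_pow_mem_subalgebra _) (hyA j)) hL' hLA'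
      (hR'.congr fun N => ?_)
    refine Finset.sum_congr rfl fun n _ => ?_
    congr 1
    exact Finset.prod_congr rfl fun j _ => by ring
  have hYA : (∏ j, y j)⁻¹ ∈ A := by
    rw [← Finset.prod_inv_distrib]
    exact prod_mem fun j _ => hyA' j
  have hY : (∏ j, y j)⁻¹ * ∏ j, y j = 1 :=
    inv_mul_cancel₀ (Finset.prod_ne_zero_iff.2 fun j _ => (hy j).ne_zero_complex)
  rw [Finset.prod_const, Finset.card_univ, Fintype.card_fin] at m1
  rw [Finset.prod_mul_distrib, Finset.prod_pow_eq_pow_sum] at m2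
  have m3 := sub_mem hV'A (mul_mem hYA (add_mem m1 (mul_mem (neg_one_pow_mem_subalgebra q) m2)))
  -- Multiplying by (-1)^r moves the sign from the first top term to the second.
  have m4 := mul_mem (neg_one_pow_mem_subalgebra (A := A) r) m3
  have hrr : ((-1 : ℂ) ^ r) * (-1) ^ r = 1 := by rw [← mul_pow]; norm_num
  convert m4 using 1
  rw [hV'eq, pow_add, pow_add]
  linear_combination (-(∏ j, y j)⁻¹ * L Finset.univ) * hrr
    - ((-1) ^ (∑ j, p j) * (-1) ^ q * (-1) ^ r * L' Finset.univ) * hY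

end Main

theorem theorem1p2 (r : ℕ) (hr : 1 ≤ r) (p : Fin r → ℕ) (q : ℕ) (y : Fin r → ℂ) (x : ℂ)
    (hp : ∀ j, 1 ≤ p j) (hq : 1 ≤ q)
    (hy : ∀ j, IsOfFinOrder (y j)) (hx : IsOfFinOrder x)
    (hpy : ∀ j, (p j, y j) ≠ (1, 1)) (hqx : (q, x) ≠ (1, 1)) :
    ∃ A B : ℂ, IsTildeSSum p q y x A ∧ IsTildeSSum p q (fun j => (y j)⁻¹) x⁻¹ B ∧
      (∏ j, y j)⁻¹ * A + (-1) ^ ((∑ j, p j) + q + r) * B ∈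
        Algebra.adjoin (IntermediateField.adjoin ℚ (insert x (Set.range y)))
          (lowerOrderSums r) := by
  generalize hF : IntermediateField.adjoin ℚ (insert x (Set.range y)) = F
  have hxF : x ∈ F := hF ▸ IntermediateField.subset_adjoin _ _ (Set.mem_insert _ _)
  have hyF : ∀ j, y j ∈ F := fun j =>
    hF ▸ IntermediateField.subset_adjoin _ _ (Set.mem_insert_of_mem _ ⟨j, rfl⟩)
  -- The parity argument needs only a ℚ-subalgebra containing the lower order sums, x, the y_j and
  -- their inverses; restricting scalars provides one.
  obtain ⟨B, hB⟩ : ∃ B : Subalgebra ℚ ℂ, ∀ z, z ∈ B ↔ z ∈ Algebra.adjoin F (lowerOrderSums r) :=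
    ⟨(Algebra.adjoin F (lowerOrderSums r)).restrictScalars ℚ,
      fun _ => Subalgebra.mem_restrictScalars _⟩
  have hFB : ∀ z ∈ F, z ∈ B := fun z hz =>
    (hB z).2 ((Algebra.adjoin F (lowerOrderSums r)).algebraMap_mem ⟨z, hz⟩)
  obtain ⟨a, b, ha, hb, hab⟩ := tildeSSum_parity (A := B) hr
    (fun z hz => (hB z).2 (Algebra.subset_adjoin hz)) hp hq hy hx (fun j => hFB _ (hyF j))
    (fun j => hFB _ (inv_mem (hyF j))) (hFB _ hxF) (hFB _ (inv_mem hxF)) hpy hqx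
  exact ⟨a, b, ha, hb, (hB _).1 hab⟩
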